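/- Let $n\ge 1$ be an integer and let $\omega_1,\omega_2\ge 0$ with $\omega_1\neq\omega_2$, $\omega_1\neq 1$. For real $s_1<s_2$ let $$w(t)=w(t;s_1,s_2)=e^{-t^2}\cdot\begin{cases}1,& t<s_1,\\ \omega_1,& s_1<t<s_2,\\ \omega_2,& t>s_2,\end{cases}\qquad D_n(s_1,s_2)=\det\Big(\int_{\mathbb R}t^{j+k}w(t)\,dt\Big)_{j,k=0}^{n-1}.$$ Let $\pi_m(t)=\pi_m(t;s_1,s_2)$, $m\ge 0$, be the monic orthogonal polynomials of $w$, with $\int_{\mathbb R}\pi_l\pi_m w\,dt=\gamma_m^{-2}\delta_{lm}$ and $\gamma_m=\gamma_m(s_1,s_2)>0$, and let $\alpha_n,\beta_n^2$ be the coefficients in $t\,\pi_n(t)=\pi_{n+1}(t)+\alpha_n\pi_n(t)+\beta_n^2\pi_{n-1}(t)$. (These objects are all well defined, and $D_n>0$.) Put $$F(s_1,s_2)=\frac{\partial}{\partial s_1}\ln D_n+\frac{\partial}{\partial s_2}\ln D_n,\qquad x=\frac{s_1+s_2}{2},\quad s=\frac{s_2-s_1}{2},$$ so that $s_1=x-s$,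 $s_2=x+s$, $s>0$; $\frac{d}{dx}$ is taken with $s$ fixed. Let $$H_{\rm IV}=-2(a_1b_1+a_2b_2+n)(a_1+a_2)+2\big(a_1b_1(x-s)+a_2b_2(x+s)+nx\big)-(a_1b_1^2+a_2b_2^2).$$ Then there are real-valued functions $a_k(x;s)$, $b_k(x;s)$, $k=1,2$, and a complex-valued function $y(x;s)$, of $x\in\mathbb R$ and $s>0$, such that for every fixed $s>0$ the following holds. Let $P_s$ be the set of all $x$ with $\pi_{n-1}(s_1;s_1,s_2)=0$ or $\pi_{n-1}(s_2;s_1,s_2)=0$. The set $P_s$ has no accumulation point in $\mathbb R$. For $k=1,2$, $a_k$ is continuous in $x\in\mathbb R$, and $|b_k|\to\infty$ at every $x$ where $\pi_{n-1}(s_k;s_1,s_2)=0$. For all $x\notin P_s$ the coupled Painlevé IV system, which is the Hamiltonian system $a_k'=\partial H_{\rm IV}/\partial b_k$, $b_k'=-\partial H_{\rm IV}/\partial a_k$, holds: $$\begin{aligned} \tfrac{d a_1}{dx}&=-2a_1(a_1+a_2+b_1-x+s), & \tfrac{d b_1}{dx}&=b_1^2+2b_1(2a_1+a_2-x+s)+2(a_2b_2+n),\\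 \tfrac{d a_2}{dx}&=-2a_2(a_1+a_2+b_2-x-s), & \tfrac{d b_2}{dx}&=b_2^2+2b_2(a_1+2a_2-x-s)+2(a_1b_1+n). \end{aligned}$$ For all $x\in\mathbb R$, $$\frac{dy}{dx}=2(a_1+a_2-x)y,\qquad \gamma_{n-1}^2=\frac{1}{4\pi i}e^{x^2}y\neq 0,\qquad \frac{d}{dx}\ln\gamma_{n-1}=a_1+a_2.$$ For all $x\notin P_s$ one has $a_1b_1+a_2b_2+n\ne 0$ and $$F(s_1,s_2)=H_{\rm IV}(x;s)-2nx,$$ $$\alpha_n=\frac{a_1b_1^2+a_2b_2^2}{2(a_1b_1+a_2b_2+n)},\qquad \beta_n^2=\frac12(a_1b_1+a_2b_2+n),$$ $$\pi_n(s_1)^2=\frac{2\pi i}{\omega_1-1}e^{-2sx+s^2}\frac{a_1b_1^2}{y},\qquad \pi_n(s_2)^2=\frac{2\pi i}{\omega_2-\omega_1}e^{2sx+s^2}\frac{a_2b_2^2}{y},$$ and at the points $x\in P_s$ the right-hand sides of these last five formulas have removable singularities whose limits are the left-hand sides, so that the formulas hold there in the sense of limits. -/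

import Mathlib

open MeasureTheory Filter Topology Polynomial

noncomputable section

/-- The Gaussian weight with two jumps: `exp (-t²)` times `1`, `ω₁`, `ω₂` to the left of `s₁`,
between `s₁` and `s₂`, and to the right of `s₂`.  (The values at the two jump points themselves
are immaterial: the weight is only ever integrated.) -/
def jumpWeight (ω₁ ω₂ s₁ s₂ t : ℝ) : ℝ :=
  Real.exp (-t ^ 2) * (if t < s₁ then 1 else if t < s₂ then ω₁ else ω₂)

/-- The `n × n` Hankel determinant of the moments of the weight. -/
def hankelDet (ω₁ ω₂ : ℝ) (n : ℕ) (s₁ s₂ : ℝ) : ℝ :=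
  Matrix.det (Matrix.of fun j k : Fin n =>
    ∫ t, t ^ ((j : ℕ) + (k : ℕ)) * jumpWeight ω₁ ω₂ s₁ s₂ t)

/-- The monic orthogonal polynomials `π_n` of a weight `w` on the real line, by the Gram-Schmidt
process applied to the monomials:
`π_n = X ^ n - ∑_{k < n} (∫ t ^ n π_k w / ∫ π_k² w) π_k`. -/
def monicOrthPoly (w : ℝ → ℝ) (n : ℕ) : ℝ[X] :=
  X ^ n - ∑ k : Fin n,
    C ((∫ t, t ^ n * (monicOrthPoly w k).eval t * w t) /
        (∫ t, (monicOrthPoly w k).eval t ^ 2 * w t)) * monicOrthPoly w k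
termination_by n
decreasing_by all_goals exact k.is_lt

/-- `π_n(· ; s₁, s₂)` for the Gaussian weight with two jumps. -/
def jumpOP (ω₁ ω₂ : ℝ) (n : ℕ) (s₁ s₂ : ℝ) : ℝ[X] :=
  monicOrthPoly (jumpWeight ω₁ ω₂ s₁ s₂) n

/-- The leading coefficient `γ_n > 0` of the orthonormal polynomial: `γ_n ^ (-2) = ∫ π_n² w`. -/
def jumpGamma (ω₁ ω₂ : ℝ) (n : ℕ) (s₁ s₂ : ℝ) : ℝ :=
  (Real.sqrt (∫ t, (jumpOP ω₁ ω₂ n s₁ s₂).eval t ^ 2 * jumpWeight ω₁ ω₂ s₁ s₂ t))⁻¹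

/-- The recurrence coefficient `α_n = ∫ t π_n² w / ∫ π_n² w`. -/
def jumpAlpha (ω₁ ω₂ : ℝ) (n : ℕ) (s₁ s₂ : ℝ) : ℝ :=
  (∫ t, t * (jumpOP ω₁ ω₂ n s₁ s₂).eval t ^ 2 * jumpWeight ω₁ ω₂ s₁ s₂ t) /
    ∫ t, (jumpOP ω₁ ω₂ n s₁ s₂).eval t ^ 2 * jumpWeight ω₁ ω₂ s₁ s₂ t

/-- The recurrence coefficient `β_n = γ_{n-1} / γ_n` (for `n ≥ 1`). -/
def jumpBeta (ω₁ ω₂ : ℝ) (n : ℕ) (s₁ s₂ : ℝ) : ℝ :=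
  jumpGamma ω₁ ω₂ (n - 1) s₁ s₂ / jumpGamma ω₁ ω₂ n s₁ s₂

/-- `F(s₁, s₂) = ∂ ln D_n / ∂s₁ + ∂ ln D_n / ∂s₂`. -/
def hankelLogDeriv (ω₁ ω₂ : ℝ) (n : ℕ) (s₁ s₂ : ℝ) : ℝ :=
  deriv (fun u => Real.log (hankelDet ω₁ ω₂ n u s₂)) s₁ +
    deriv (fun v => Real.log (hankelDet ω₁ ω₂ n s₁ v)) s₂

/-- The Hamiltonian `H_IV(a₁, a₂, b₁, b₂; x; s)` of the coupled Painlevé IV system. -/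
def hamiltonianIV (n : ℕ) (a₁ a₂ b₁ b₂ x s : ℝ) : ℝ :=
  -2 * (a₁ * b₁ + a₂ * b₂ + n) * (a₁ + a₂) +
    2 * (a₁ * b₁ * (x - s) + a₂ * b₂ * (x + s) + n * x) - (a₁ * b₁ ^ 2 + a₂ * b₂ ^ 2)

/-- The four functions of `(x, s)` satisfy the coupled Painlevé IV system at the point `x`, for
the given fixed value of the parameter `s`. -/
structure SolvesCoupledPIVAt (n : ℕ) (a₁ a₂ b₁ b₂ : ℝ → ℝ → ℝ) (s x : ℝ) : Prop where
  deriv_a₁ : HasDerivAt (fun t => a₁ t s)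
    (-2 * a₁ x s * (a₁ x s + a₂ x s + b₁ x s - x + s)) x
  deriv_a₂ : HasDerivAt (fun t => a₂ t s)
    (-2 * a₂ x s * (a₁ x s + a₂ x s + b₂ x s - x - s)) x
  deriv_b₁ : HasDerivAt (fun t => b₁ t s)
    (b₁ x s ^ 2 + 2 * b₁ x s * (2 * a₁ x s + a₂ x s - x + s) + 2 * (a₂ x s * b₂ x s + n)) x
  deriv_b₂ : HasDerivAt (fun t => b₂ t s)
    (b₂ x s ^ 2 + 2 * b₂ x s * (a₁ x s + 2 * a₂ x s - x - s) + 2 * (a₁ x s * b₁ x s + n)) x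

/-- The right-hand sides of the coupled Painlevé IV system are `∂H/∂b₁`, `∂H/∂b₂`, `-∂H/∂a₁`,
`-∂H/∂a₂`. -/
theorem hamiltonianIV_partials (n : ℕ) (a₁ a₂ b₁ b₂ x s : ℝ) :
    HasDerivAt (fun b => hamiltonianIV n a₁ a₂ b b₂ x s)
      (-2 * a₁ * (a₁ + a₂ + b₁ - x + s)) b₁ ∧
    HasDerivAt (fun b => hamiltonianIV n a₁ a₂ b₁ b x s)
      (-2 * a₂ * (a₁ + a₂ + b₂ - x - s)) b₂ ∧
    HasDerivAt (fun a => -hamiltonianIV n a a₂ b₁ b₂ x s)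
      (b₁ ^ 2 + 2 * b₁ * (2 * a₁ + a₂ - x + s) + 2 * (a₂ * b₂ + n)) a₁ ∧
    HasDerivAt (fun a => -hamiltonianIV n a₁ a b₁ b₂ x s)
      (b₂ ^ 2 + 2 * b₂ * (a₁ + 2 * a₂ - x - s) + 2 * (a₁ * b₁ + n)) a₂ := by
  -- each partial function is a quadratic polynomial
  have key : ∀ (p q r v d : ℝ) (f : ℝ → ℝ), (∀ u, f u = p * u ^ 2 + q * u + r) →
      d = 2 * p * v + q → HasDerivAt f d v := by
    intro p q r v d f hf hd
    have h := ((hasDerivAt_pow 2 v).const_mul p).add ((hasDerivAt_id' v).const_mul q)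
    have h2 := h.add_const r
    have e : f = fun u => p * u ^ 2 + q * u + r := funext hf
    rw [e, hd]
    refine h2.congr_deriv ?_
    push_cast
    ring
  refine ⟨?_, ?_, ?_, ?_⟩
  · refine key (-a₁) (-2 * a₁ * (a₁ + a₂) + 2 * a₁ * (x - s))
      (hamiltonianIV n a₁ a₂ 0 b₂ x s) _ _ _ (fun u => ?_) ?_ <;>
      (try simp only [hamiltonianIV]) <;> ring
  · refine key (-a₂) (-2 * a₂ * (a₁ + a₂) + 2 * a₂ * (x + s))
      (hamiltonianIV n a₁ a₂ b₁ 0 x s) _ _ _ (fun u => ?_) ?_ <;>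
      (try simp only [hamiltonianIV]) <;> ring
  · refine key (2 * b₁) (2 * b₁ * a₂ + 2 * (a₂ * b₂ + n) - 2 * b₁ * (x - s) + b₁ ^ 2)
      (-hamiltonianIV n 0 a₂ b₁ b₂ x s) _ _ _ (fun u => ?_) ?_ <;>
      (try simp only [hamiltonianIV]) <;> ring
  · refine key (2 * b₂) (2 * b₂ * a₁ + 2 * (a₁ * b₁ + n) - 2 * b₂ * (x + s) + b₂ ^ 2)
      (-hamiltonianIV n a₁ 0 b₁ b₂ x s) _ _ _ (fun u => ?_) ?_ <;>
      (try simp only [hamiltonianIV]) <;> ring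

/-- For fixed `s`, the points `x` at which `π_{n-1}` vanishes at one of the jumps `x - s`, `x + s`:
these are the poles of `b₁` and `b₂`. -/
def polesPIV (ω₁ ω₂ : ℝ) (n : ℕ) (s : ℝ) : Set ℝ :=
  {x | (jumpOP ω₁ ω₂ (n - 1) (x - s) (x + s)).eval (x - s) = 0 ∨
    (jumpOP ω₁ ω₂ (n - 1) (x - s) (x + s)).eval (x + s) = 0}

/-- `f = g` off `P`, and at the points of `P` the function `f` has a removable singularity with
value `g`. -/
def EqUpToRemovable {E : Type} [TopologicalSpace E] (P : Set ℝ) (f g : ℝ → E) : Prop :=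
  (∀ x, x ∉ P → f x = g x) ∧ ∀ x ∈ P, Tendsto f (𝓝[≠] x) (𝓝 (g x))

end

/-!
All functions in the coupled Painlevé IV system are explicit in the orthogonal polynomials at the two
jumps. Let `h_m = ∫ π_m² w`, and let `E₁ = (ω₁ - 1) e^{-s₁²}`, `E₂ = (ω₂ - ω₁) e^{-s₂²}` be the heights
of the jumps of `w`. Then
`a_k = E_k π_{n-1}(s_k)² / (2 h_{n-1})`, `b_k = 2 π_n(s_k) / π_{n-1}(s_k)`,
`y = 4 π i e^{-x²} / h_{n-1}`.

Write `L(p) = ∫ p w`. Integration by parts gives `L(p' - 2 t p) = -∑ E_k p(s_k)`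
(`jumpFunctional_derivative_sub`). Applied to `π_m²`, to `π_n π_{n-1}` and to `t π_n π_{n-1}` it
yields `α_{n-1} = a₁ + a₂`, the formulas for `α_n` and `β_n²`, and the relation
`∑ s_k a_k b_k = c + 2 (α_n + α_{n-1}) β_n²`, where `c = -∑_{j < n} α_j` is the second
coefficient of `π_n` (`two_mul_diagCoeff_mul`, `two_mul_normSq_succ`, `sum_mul_eval_mul_eval`). As
`D_n = ∏ h_m`, one finds `F = -2 ∑_{j < n} α_j = 2 c`, and this is `H_IV - 2 n x`.

If both jumps are translated by `x`, then `dL(p)/dx` has the same boundary terms, so that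
`dL(p)/dx = L(p' - 2 t p)`. Differentiating the orthogonality relations shows that the values
`π_m(s_k)` evolve by the Toda lattice,
`d π_m(s_k) / dx = 2 ((s_k - α_m) π_m(s_k) - π_{m+1}(s_k)) = 2 β_m² π_{m-1}(s_k)`, and
`d h_m / dx = -2 α_m h_m` (`hasDerivAt_eval_of_translation`, `hasDerivAt_normSq`). The differential
equations for `a_k`, `b_k`, `y` follow by the quotient rule. At a zero of `π_{n-1}(s_k)` the first
form of the derivative is `-2 π_n(s_k)`, which is nonzero because consecutive orthogonal polynomials
have no common zero: the zeros are isolated and are poles of `b_k`. The left-hand sides of the formulas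
with removable singularities are continuous in `x`, so the limits come for free.
-/

/-! ### The moment functional of the weight -/

theorem integrable_eval_mul_exp_neg_sq (p : ℝ[X]) :
    Integrable fun t : ℝ => p.eval t * Real.exp (-t ^ 2) := by
  induction p using Polynomial.induction_on' with
  | add p q hp hq =>
    simp only [eval_add, add_mul]
    exact hp.add hq
  | monomial k a =>
    have h := (integrable_rpow_mul_exp_neg_mul_sq (b := 1) one_pos (s := k)
      (by linarith [k.cast_nonneg (α := ℝ)])).const_mul a
    refine h.congr (ae_of_all _ fun t => ?_)
    simp only [Real.rpow_natCast, eval_monomial, neg_mul, one_mul]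
    ring

theorem integrable_eval_mul_jumpWeight (ω₁ ω₂ s₁ s₂ : ℝ) (p : ℝ[X]) :
    Integrable fun t => p.eval t * jumpWeight ω₁ ω₂ s₁ s₂ t := by
  have hm : Measurable fun t : ℝ => if t < s₁ then 1 else if t < s₂ then ω₁ else ω₂ :=
    Measurable.ite measurableSet_Iio measurable_const
      (Measurable.ite measurableSet_Iio measurable_const measurable_const)
  refine ((integrable_eval_mul_exp_neg_sq p).mul_bdd (c := 1 + |ω₁| + |ω₂|)
    hm.aestronglyMeasurable (ae_of_all _ fun t => ?_)).congr (ae_of_all _ fun t => ?_)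
  · have h1 := abs_nonneg ω₁
    have h2 := abs_nonneg ω₂
    rw [Real.norm_eq_abs]
    split_ifs
    · rw [abs_one]; linarith
    · linarith
    · linarith
  · simp only [jumpWeight]
    ring

/-- The moment functional `p ↦ ∫ p w` of the Gaussian weight with two jumps. -/
noncomputable def jumpFunctional (ω₁ ω₂ s₁ s₂ : ℝ) : ℝ[X] →ₗ[ℝ] ℝ where
  toFun p := ∫ t, p.eval t * jumpWeight ω₁ ω₂ s₁ s₂ t
  map_add' p q := by
    simp only [eval_add, add_mul]
    exact integral_add (integrable_eval_mul_jumpWeight ..) (integrable_eval_mul_jumpWeight ..)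
  map_smul' c p := by
    simp only [eval_smul, smul_eq_mul, mul_assoc, RingHom.id_apply]
    exact integral_const_mul _ _

theorem jumpFunctional_apply (ω₁ ω₂ s₁ s₂ : ℝ) (p : ℝ[X]) :
    jumpFunctional ω₁ ω₂ s₁ s₂ p = ∫ t, p.eval t * jumpWeight ω₁ ω₂ s₁ s₂ t := rfl

/-- Positivity needs only that the weight is nonnegative and does not vanish left of `s₁`. -/
theorem jumpFunctional_sq_pos {ω₁ ω₂ : ℝ} (hω₁ : 0 ≤ ω₁) (hω₂ : 0 ≤ ω₂) (s₁ s₂ : ℝ) {p : ℝ[X]}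
    (hp : p ≠ 0) : 0 < jumpFunctional ω₁ ω₂ s₁ s₂ (p * p) := by
  rw [jumpFunctional_apply, integral_pos_iff_support_of_nonneg]
  · have hsub : Set.Iio s₁ \ (p.roots.toFinset : Set ℝ) ⊆
        Function.support fun t => (p * p).eval t * jumpWeight ω₁ ω₂ s₁ s₂ t := by
      rintro t ⟨ht, hr⟩
      have hr' : p.eval t ≠ 0 := by simpa [hp] using hr
      simp only [Function.mem_support, eval_mul, jumpWeight, if_pos (Set.mem_Iio.1 ht), mul_one]
      exact mul_ne_zero (mul_ne_zero hr' hr') (Real.exp_pos _).ne'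
    refine lt_of_lt_of_le ?_ (measure_mono hsub)
    rw [measure_sdiff_null ((p.roots.toFinset.finite_toSet).measure_zero volume)]
    simp
  · intro t
    simp only [Pi.zero_apply, eval_mul, jumpWeight]
    refine mul_nonneg (mul_self_nonneg _) (mul_nonneg (Real.exp_pos _).le ?_)
    split_ifs <;> first | exact zero_le_one | assumption
  · exact integrable_eval_mul_jumpWeight ..

/-- The incomplete Gaussian moment `∫_{t ≤ u} p(t) e^{-t²} dt`. -/
noncomputable def gaussIic (p : ℝ[X]) (u : ℝ) : ℝ :=
  ∫ t in Set.Iic u, p.eval t * Real.exp (-t ^ 2)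

/-- Layer-cake form of the functional: the weight is `ω₂` plus a jump `ω₁ - ω₂` on `t < s₂` and a
jump `1 - ω₁` on `t < s₁`. -/
theorem jumpFunctional_eq_gaussIic (ω₁ ω₂ : ℝ) {s₁ s₂ : ℝ} (hs : s₁ ≤ s₂) (p : ℝ[X]) :
    jumpFunctional ω₁ ω₂ s₁ s₂ p = ω₂ * (∫ t, p.eval t * Real.exp (-t ^ 2)) +
      (ω₁ - ω₂) * gaussIic p s₂ + (1 - ω₁) * gaussIic p s₁ := by
  have hI := integrable_eval_mul_exp_neg_sq p
  rw [jumpFunctional_apply, gaussIic, gaussIic, integral_Iic_eq_integral_Iio,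
    integral_Iic_eq_integral_Iio, ← integral_indicator measurableSet_Iio,
    ← integral_indicator measurableSet_Iio, ← integral_const_mul, ← integral_const_mul,
    ← integral_const_mul, ← integral_add, ← integral_add]
  · refine integral_congr_ae (ae_of_all _ fun t => ?_)
    simp only [jumpWeight, Set.indicator, Set.mem_Iio]
    by_cases h1 : t < s₁
    · rw [if_pos h1, if_pos h1, if_pos (h1.trans_le hs)]; ring
    · by_cases h2 : t < s₂
      · rw [if_neg h1, if_neg h1, if_pos h2, if_pos h2]; ring
      · rw [if_neg h1, if_neg h1, if_neg h2, if_neg h2]; ring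
  · exact (hI.const_mul _).add ((hI.indicator measurableSet_Iio).const_mul _)
  · exact (hI.indicator measurableSet_Iio).const_mul _
  · exact hI.const_mul _
  · exact (hI.indicator measurableSet_Iio).const_mul _

theorem hasDerivAt_gaussIic (p : ℝ[X]) (u : ℝ) :
    HasDerivAt (gaussIic p) (p.eval u * Real.exp (-u ^ 2)) u := by
  have hI := integrable_eval_mul_exp_neg_sq p
  have hc : Continuous fun t : ℝ => p.eval t * Real.exp (-t ^ 2) := by fun_prop
  have h := ((hc.integral_hasStrictDerivAt u u).hasDerivAt).const_add (gaussIic p u)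
  refine h.congr_of_eventuallyEq (Eventually.of_forall fun v => ?_)
  simp only [gaussIic]
  rw [← intervalIntegral.integral_Iic_sub_Iic hI.integrableOn hI.integrableOn]
  ring

theorem hasDerivAt_eval_mul_exp_neg_sq (p : ℝ[X]) (t : ℝ) :
    HasDerivAt (fun t : ℝ => p.eval t * Real.exp (-t ^ 2))
      ((derivative p - 2 * X * p).eval t * Real.exp (-t ^ 2)) t := by
  have h := (p.hasDerivAt t).mul ((hasDerivAt_pow 2 t).neg.exp)
  refine h.congr_deriv ?_
  simp
  ring

theorem gaussIic_derivative_sub (p : ℝ[X]) (u : ℝ) :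
    gaussIic (derivative p - 2 * X * p) u = p.eval u * Real.exp (-u ^ 2) := by
  have h1 := integrable_eval_mul_exp_neg_sq p
  have h2 := integrable_eval_mul_exp_neg_sq (derivative p - 2 * X * p)
  have hd := hasDerivAt_eval_mul_exp_neg_sq p
  have h0 := tendsto_zero_of_hasDerivAt_of_integrableOn_Iic (a := u) (fun t _ => hd t)
    h2.integrableOn h1.integrableOn
  rw [gaussIic, integral_Iic_of_hasDerivAt_of_tendsto' (fun t _ => hd t) h2.integrableOn h0,
    sub_zero]

/-- The height `c e^{-u²}` of a jump at `u`, where `c` is the height relative to the Gaussian. -/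
noncomputable def jumpMass (c u : ℝ) : ℝ := c * Real.exp (-u ^ 2)

/-- Integration by parts: the boundary terms sit at the two jumps. -/
theorem jumpFunctional_derivative_sub (ω₁ ω₂ : ℝ) {s₁ s₂ : ℝ} (hs : s₁ ≤ s₂) (p : ℝ[X]) :
    jumpFunctional ω₁ ω₂ s₁ s₂ (derivative p - 2 * X * p) =
      -(jumpMass (ω₁ - 1) s₁ * p.eval s₁ + jumpMass (ω₂ - ω₁) s₂ * p.eval s₂) := by
  rw [jumpFunctional_eq_gaussIic _ _ hs, gaussIic_derivative_sub, gaussIic_derivative_sub,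
    integral_eq_zero_of_hasDerivAt_of_integrable (hasDerivAt_eval_mul_exp_neg_sq p)
      (integrable_eval_mul_exp_neg_sq _) (integrable_eval_mul_exp_neg_sq p), jumpMass, jumpMass]
  ring

/-- Derivative of the functional, at a fixed polynomial, when the jumps move. -/
theorem hasDerivAt_jumpFunctional (ω₁ ω₂ : ℝ) {σ₁ σ₂ : ℝ → ℝ} {τ d₁ d₂ : ℝ}
    (h₁ : HasDerivAt σ₁ d₁ τ) (h₂ : HasDerivAt σ₂ d₂ τ) (hs : σ₁ τ < σ₂ τ) (p : ℝ[X]) :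
    HasDerivAt (fun t => jumpFunctional ω₁ ω₂ (σ₁ t) (σ₂ t) p)
      (-(jumpMass (ω₁ - 1) (σ₁ τ) * d₁ * p.eval (σ₁ τ) +
        jumpMass (ω₂ - ω₁) (σ₂ τ) * d₂ * p.eval (σ₂ τ))) τ := by
  have g₁ := (hasDerivAt_gaussIic p (σ₁ τ)).comp τ h₁
  have g₂ := (hasDerivAt_gaussIic p (σ₂ τ)).comp τ h₂
  have h := ((g₂.const_mul (ω₁ - ω₂)).const_add
    (ω₂ * ∫ t, p.eval t * Real.exp (-t ^ 2))).add (g₁.const_mul (1 - ω₁))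
  have hev : ∀ᶠ t in 𝓝 τ, σ₁ t < σ₂ t :=
    h₁.continuousAt.eventually_lt h₂.continuousAt hs
  refine (h.congr_of_eventuallyEq ?_).congr_deriv ?_
  · filter_upwards [hev] with t ht
    rw [jumpFunctional_eq_gaussIic _ _ ht.le]
    rfl
  · simp only [jumpMass]
    ring

/-! ### Orthogonal polynomials of a positive functional -/

/-- `π` is the sequence of monic orthogonal polynomials of the linear functional `L`, with positive
squared norms `L(π_m²)`. -/
structure IsMonicOrthogonal (L : ℝ[X] →ₗ[ℝ] ℝ) (π : ℕ → ℝ[X]) : Prop where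
  monic : ∀ m, (π m).Monic
  natDegree_eq : ∀ m, (π m).natDegree = m
  orthogonal : ∀ l m, l ≠ m → L (π l * π m) = 0
  norm_pos : ∀ m, 0 < L (π m * π m)

/-- The diagonal recurrence coefficient `α_m = L(t π_m²) / L(π_m²)`. -/
noncomputable def diagCoeff (L : ℝ[X] →ₗ[ℝ] ℝ) (π : ℕ → ℝ[X]) (m : ℕ) : ℝ :=
  L (X * (π m * π m)) / L (π m * π m)

theorem LinearMap.map_C_mul (L : ℝ[X] →ₗ[ℝ] ℝ) (c : ℝ) (p : ℝ[X]) : L (C c * p) = c * L p := by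
  rw [← smul_eq_C_mul, map_smul, smul_eq_mul]

namespace IsMonicOrthogonal

variable {L : ℝ[X] →ₗ[ℝ] ℝ} {π : ℕ → ℝ[X]}

theorem coeff_self (h : IsMonicOrthogonal L π) (m : ℕ) : (π m).coeff m = 1 := by
  have := h.monic m
  rwa [Monic, leadingCoeff, h.natDegree_eq] at this

theorem coeff_of_lt (h : IsMonicOrthogonal L π) {m k : ℕ} (hk : m < k) : (π m).coeff k = 0 :=
  coeff_eq_zero_of_natDegree_lt (by rwa [h.natDegree_eq])

theorem eq_one (h : IsMonicOrthogonal L π) : π 0 = 1 :=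
  (h.monic 0).natDegree_eq_zero.1 (h.natDegree_eq 0)

theorem map_mul_eq_zero (h : IsMonicOrthogonal L π) (m : ℕ) {q : ℝ[X]} (hq : q.degree < m) :
    L (π m * q) = 0 := by
  suffices H : ∀ d ≤ m, ∀ q : ℝ[X], q.degree < d → L (π m * q) = 0 from H m le_rfl q hq
  intro d
  induction d with
  | zero =>
    intro _ q hq
    have : q = 0 := by simpa [degree_lt_iff_coeff_zero, Polynomial.ext_iff] using hq
    rw [this, mul_zero, map_zero]
  | succ d ih =>
    intro hd q hq
    rw [degree_lt_iff_coeff_zero] at hq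
    have hr : (q - C (q.coeff d) * π d).degree < d := by
      rw [degree_lt_iff_coeff_zero]
      intro k hk
      rw [coeff_sub, coeff_C_mul]
      rcases hk.eq_or_lt with rfl | hk
      · rw [h.coeff_self, mul_one, sub_self]
      · rw [hq k hk, h.coeff_of_lt hk, mul_zero, sub_zero]
    have e : π m * q = π m * (q - C (q.coeff d) * π d) + C (q.coeff d) * (π m * π d) := by ring
    rw [e, map_add, ih (by omega) _ hr, L.map_C_mul, h.orthogonal m d (by omega)]
    ring

/-- Against `π_m`, a polynomial of degree at most `m` contributes its top coefficient only. -/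
theorem map_mul_eq (h : IsMonicOrthogonal L π) (m : ℕ) {q : ℝ[X]} (hq : ∀ k, m < k → q.coeff k = 0) :
    L (π m * q) = q.coeff m * L (π m * π m) := by
  have hr : (q - C (q.coeff m) * π m).degree < m := by
    rw [degree_lt_iff_coeff_zero]
    intro k hk
    rw [coeff_sub, coeff_C_mul]
    rcases hk.eq_or_lt with rfl | hk
    · rw [h.coeff_self, mul_one, sub_self]
    · rw [hq k hk, h.coeff_of_lt hk, mul_zero, sub_zero]
  have e : π m * q = π m * (q - C (q.coeff m) * π m) + C (q.coeff m) * (π m * π m) := by ring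
  rw [e, map_add, h.map_mul_eq_zero m hr, L.map_C_mul, zero_add]

/-- The criterion behind all identities between polynomials below: expansion in the `π_j` is
unique. -/
theorem eq_zero_of_map_mul (h : IsMonicOrthogonal L π) {n : ℕ} {r : ℝ[X]}
    (hr : ∀ k, n < k → r.coeff k = 0) (h0 : ∀ j ≤ n, L (π j * r) = 0) : r = 0 := by
  by_contra hne
  have hle : r.natDegree ≤ n := by
    by_contra! hlt
    exact hne (leadingCoeff_eq_zero.1 (hr _ hlt))
  have := h.map_mul_eq r.natDegree (q := r) fun k hk => coeff_eq_zero_of_natDegree_lt hk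
  rw [h0 _ hle] at this
  rcases mul_eq_zero.1 this.symm with h1 | h1
  · exact hne (leadingCoeff_eq_zero.1 h1)
  · exact (h.norm_pos _).ne' h1

theorem map_X_mul_self (h : IsMonicOrthogonal L π) (m : ℕ) :
    L (X * (π m * π m)) = diagCoeff L π m * L (π m * π m) := by
  rw [diagCoeff, div_mul_cancel₀ _ (h.norm_pos m).ne']

theorem map_X_mul_of_lt (h : IsMonicOrthogonal L π) {j m : ℕ} (hj : j + 1 < m) :
    L (X * (π j * π m)) = 0 := by
  have e : X * (π j * π m) = π m * (X * π j) := by ring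
  rw [e, h.map_mul_eq_zero]
  rw [degree_lt_iff_coeff_zero]
  intro k hk
  obtain ⟨k, rfl⟩ : ∃ i, k = i + 1 := ⟨k - 1, by omega⟩
  rw [coeff_X_mul, h.coeff_of_lt (by omega)]

theorem map_X_mul_succ (h : IsMonicOrthogonal L π) (m : ℕ) :
    L (X * (π m * π (m + 1))) = L (π (m + 1) * π (m + 1)) := by
  have e : X * (π m * π (m + 1)) = π (m + 1) * (X * π m) := by ring
  rw [e, h.map_mul_eq, coeff_X_mul, h.coeff_self, one_mul]
  intro k hk
  obtain ⟨k, rfl⟩ : ∃ i, k = i + 1 := ⟨k - 1, by omega⟩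
  rw [coeff_X_mul, h.coeff_of_lt (by omega)]

/-- The coefficients of `t π_m - α π_m - π_{m+1}` vanish above degree `m`. -/
theorem coeff_X_sub_C_mul_sub (h : IsMonicOrthogonal L π) (a : ℝ) {m k : ℕ} (hk : m < k) :
    ((X - C a) * π m - π (m + 1)).coeff k = 0 := by
  obtain ⟨k, rfl⟩ : ∃ i, k = i + 1 := ⟨k - 1, by omega⟩
  rw [coeff_sub, sub_mul, coeff_sub, coeff_X_mul, coeff_C_mul, h.coeff_of_lt hk]
  rcases (Nat.lt_succ_iff.1 hk).eq_or_lt with rfl | hk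
  · rw [h.coeff_self, h.coeff_self]; ring
  · rw [h.coeff_of_lt hk, h.coeff_of_lt (by omega)]; ring

theorem recurrence (h : IsMonicOrthogonal L π) (m : ℕ) :
    X * π (m + 1) = π (m + 2) + C (diagCoeff L π (m + 1)) * π (m + 1) +
      C (L (π (m + 1) * π (m + 1)) / L (π m * π m)) * π m := by
  set α := diagCoeff L π (m + 1) with hα
  set β := L (π (m + 1) * π (m + 1)) / L (π m * π m) with hβ
  have key : (X - C α) * π (m + 1) - π (m + 2) - C β * π m = 0 := by
    refine h.eq_zero_of_map_mul (n := m + 1) (fun k hk => ?_) fun j hj => ?_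
    · rw [coeff_sub, h.coeff_X_sub_C_mul_sub α hk, coeff_C_mul, h.coeff_of_lt (by omega)]
      ring
    · have e : π j * ((X - C α) * π (m + 1) - π (m + 2) - C β * π m) =
          X * (π j * π (m + 1)) - C α * (π j * π (m + 1)) - π j * π (m + 2)
            - C β * (π j * π m) := by ring
      rw [e, map_sub, map_sub, map_sub, L.map_C_mul, L.map_C_mul,
        h.orthogonal j (m + 2) (by omega)]
      rcases hj.eq_or_lt with rfl | hj
      · rw [h.map_X_mul_self, h.orthogonal (m + 1) m (by omega)]
        ring
      · rw [h.orthogonal j (m + 1) (by omega)]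
        rcases (Nat.lt_succ_iff.1 hj).eq_or_lt with rfl | hj
        · rw [h.map_X_mul_succ, hβ, div_mul_cancel₀ _ (h.norm_pos j).ne']
          ring
        · rw [h.map_X_mul_of_lt (by omega), h.orthogonal j m (by omega)]
          ring
  linear_combination key

theorem recurrence_zero (h : IsMonicOrthogonal L π) : (X - C (diagCoeff L π 0)) * π 0 = π 1 := by
  refine sub_eq_zero.1 (h.eq_zero_of_map_mul (n := 0)
    (fun k hk => h.coeff_X_sub_C_mul_sub _ hk) fun j hj => ?_)
  obtain rfl : j = 0 := by omega
  have e : π 0 * ((X - C (diagCoeff L π 0)) * π 0 - π 1) =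
    X * (π 0 * π 0) - C (diagCoeff L π 0) * (π 0 * π 0) - π 0 * π 1 := by ring
  rw [e, map_sub, map_sub, L.map_C_mul, h.orthogonal 0 1 (by omega), h.map_X_mul_self]
  ring

/-- Consecutive orthogonal polynomials have no common zero. -/
theorem eval_succ_ne_zero (h : IsMonicOrthogonal L π) {m : ℕ} {t : ℝ} (h0 : (π m).eval t = 0) :
    (π (m + 1)).eval t ≠ 0 := by
  induction m with
  | zero => simp [h.eq_one] at h0
  | succ m ih =>
    intro h1
    have hr := congrArg (eval t) (h.recurrence m)
    simp only [eval_mul, eval_add, eval_C, h0, h1, mul_zero, zero_add] at hr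
    rcases mul_eq_zero.1 hr.symm with h2 | h2
    · exact (div_pos (h.norm_pos (m + 1)) (h.norm_pos m)).ne' h2
    · exact ih h2 h0

/-- The second coefficient of `π_m` is `-∑_{j < m} α_j`. -/
theorem coeff_pred (h : IsMonicOrthogonal L π) (m : ℕ) :
    (π (m + 1)).coeff m = -∑ j ∈ Finset.range (m + 1), diagCoeff L π j := by
  induction m with
  | zero =>
    rw [← h.recurrence_zero, h.eq_one]
    simp
  | succ m ih =>
    have hr := congrArg (fun p => coeff p (m + 1)) (h.recurrence m)
    simp only [coeff_X_mul, coeff_add, coeff_C_mul, h.coeff_self] at hr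
    rw [h.coeff_of_lt (Nat.lt_succ_self m)] at hr
    rw [Finset.sum_range_succ, neg_add, ← ih]
    linarith

end IsMonicOrthogonal

/-! ### The Gram-Schmidt polynomials and the Hankel determinant -/

theorem isMonicOrthogonal_monicOrthPoly {w : ℝ → ℝ} {L : ℝ[X] →ₗ[ℝ] ℝ}
    (hL : ∀ p, L p = ∫ t, p.eval t * w t) (hpos : ∀ p ≠ 0, 0 < L (p * p)) :
    IsMonicOrthogonal L (monicOrthPoly w) := by
  have hrec : ∀ m, monicOrthPoly w m = X ^ m - ∑ k ∈ Finset.range m,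
      C (L (X ^ m * monicOrthPoly w k) / L (monicOrthPoly w k * monicOrthPoly w k)) *
        monicOrthPoly w k := by
    intro m
    rw [monicOrthPoly, ← Fin.sum_univ_eq_sum_range (fun k =>
      C (L (X ^ m * monicOrthPoly w k) / L (monicOrthPoly w k * monicOrthPoly w k)) *
        monicOrthPoly w k)]
    simp only [hL, eval_mul, eval_pow, eval_X, sq]
  have hdeg : ∀ m, (monicOrthPoly w m).Monic ∧ (monicOrthPoly w m).natDegree = m := by
    intro m
    induction m using Nat.strong_induction_on with
    | _ m ih =>
      have hlt : (∑ k ∈ Finset.range m,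
          C (L (X ^ m * monicOrthPoly w k) / L (monicOrthPoly w k * monicOrthPoly w k)) *
            monicOrthPoly w k).degree < m := by
        rw [degree_lt_iff_coeff_zero]
        intro i hi
        rw [finsetSum_coeff]
        refine Finset.sum_eq_zero fun k hk => ?_
        rw [Finset.mem_range] at hk
        rw [coeff_C_mul, coeff_eq_zero_of_natDegree_lt (by rw [(ih k hk).2]; omega), mul_zero]
      rw [hrec m]
      have hmon := monic_X_pow_sub hlt
      refine ⟨hmon, natDegree_eq_of_degree_eq_some ?_⟩
      rw [degree_sub_eq_left_of_degree_lt (by rwa [degree_X_pow]), degree_X_pow]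
  have hne : ∀ m, L (monicOrthPoly w m * monicOrthPoly w m) ≠ 0 := fun m =>
    (hpos _ (hdeg m).1.ne_zero).ne'
  have horth : ∀ m, ∀ l < m, L (monicOrthPoly w m * monicOrthPoly w l) = 0 := by
    intro m
    induction m using Nat.strong_induction_on with
    | _ m ih =>
      intro l hl
      rw [hrec m, sub_mul, map_sub, Finset.sum_mul, map_sum,
        Finset.sum_eq_single_of_mem l (Finset.mem_range.2 hl)]
      · rw [mul_assoc, L.map_C_mul, div_mul_cancel₀ _ (hne l), sub_self]
      · intro k hk hkl
        rw [Finset.mem_range] at hk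
        rw [mul_assoc, L.map_C_mul]
        rcases lt_or_gt_of_ne hkl with h | h
        · rw [mul_comm (monicOrthPoly w k) (monicOrthPoly w l), ih l hl k h, mul_zero]
        · rw [ih k hk l h, mul_zero]
  refine ⟨fun m => (hdeg m).1, fun m => (hdeg m).2, fun l m hlm => ?_,
    fun m => hpos _ (hdeg m).1.ne_zero⟩
  rcases lt_or_gt_of_ne hlm with h | h
  · rw [mul_comm, horth m l h]
  · exact horth l m h

/-- Passing to the basis of orthogonal polynomials by a unitriangular matrix, the Hankel
determinant is the product of the squared norms. -/
theorem IsMonicOrthogonal.det_hankel {L : ℝ[X] →ₗ[ℝ] ℝ} {π : ℕ → ℝ[X]}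
    (h : IsMonicOrthogonal L π) (n : ℕ) :
    Matrix.det (Matrix.of fun j k : Fin n => L (X ^ ((j : ℕ) + (k : ℕ)))) =
      ∏ m ∈ Finset.range n, L (π m * π m) := by
  set A : Matrix (Fin n) (Fin n) ℝ := Matrix.of fun i j => (π j).coeff i with hA
  set H : Matrix (Fin n) (Fin n) ℝ :=
    Matrix.of fun j k : Fin n => L (X ^ ((j : ℕ) + (k : ℕ))) with hH
  have hdet : A.det = 1 := Matrix.det_matrixOfPolynomials (fun j : Fin n => π j)
    (fun i => h.natDegree_eq i) fun i => h.monic i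
  have hsum : ∀ j : Fin n, π j = ∑ i : Fin n, C ((π j).coeff i) * X ^ (i : ℕ) := by
    intro j
    rw [Fin.sum_univ_eq_sum_range (fun i => C ((π j).coeff i) * X ^ i)]
    exact as_sum_range_C_mul_X_pow' _ (by rw [h.natDegree_eq]; exact j.is_lt)
  have hprod : A.transpose * H * A = Matrix.diagonal fun m : Fin n => L (π m * π m) := by
    ext j k
    have e : (A.transpose * H * A) j k = L (π j * π k) := by
      conv_rhs => rw [hsum j, hsum k, Finset.sum_mul_sum, map_sum]
      simp only [map_sum, Matrix.mul_apply, Finset.sum_mul]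
      rw [Finset.sum_comm]
      refine Finset.sum_congr rfl fun i _ => Finset.sum_congr rfl fun l _ => ?_
      have e2 : C ((π j).coeff i) * X ^ (i : ℕ) * (C ((π k).coeff l) * X ^ (l : ℕ)) =
          C ((π j).coeff i * (π k).coeff l) * X ^ ((i : ℕ) + (l : ℕ)) := by
        rw [C_mul, pow_add]; ring
      rw [e2, L.map_C_mul]
      simp only [hA, hH, Matrix.transpose_apply, Matrix.of_apply]
      ring
    rw [e]
    by_cases hjk : j = k
    · rw [hjk, Matrix.diagonal_apply_eq]
    · rw [Matrix.diagonal_apply_ne _ hjk]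
      exact h.orthogonal _ _ fun hv => hjk (Fin.ext hv)
  have := congrArg Matrix.det hprod
  rw [Matrix.det_mul, Matrix.det_mul, Matrix.det_transpose, hdet, one_mul, mul_one,
    Matrix.det_diagonal, Fin.prod_univ_eq_prod_range (fun m => L (π m * π m))] at this
  exact this

/-! ### Differentiable families of polynomials -/

/-- The family `q` of polynomials, of bounded degree, has at `τ` the coefficientwise derivative
`r`. -/
structure HasPolyDerivAt (q : ℝ → ℝ[X]) (r : ℝ[X]) (τ : ℝ) : Prop where
  bounded : ∃ N, ∀ t, (q t).natDegree < N
  coeff : ∀ i, HasDerivAt (fun t => (q t).coeff i) (r.coeff i) τ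

namespace HasPolyDerivAt

variable {q q₁ q₂ : ℝ → ℝ[X]} {r r₁ r₂ : ℝ[X]} {τ : ℝ}

theorem const (p : ℝ[X]) (τ : ℝ) : HasPolyDerivAt (fun _ => p) 0 τ :=
  ⟨⟨p.natDegree + 1, fun _ => Nat.lt_succ_self _⟩, fun i => by
    simpa using hasDerivAt_const τ (p.coeff i)⟩

theorem mul (h₁ : HasPolyDerivAt q₁ r₁ τ) (h₂ : HasPolyDerivAt q₂ r₂ τ) :
    HasPolyDerivAt (fun t => q₁ t * q₂ t) (r₁ * q₂ τ + q₁ τ * r₂) τ := by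
  obtain ⟨N₁, hN₁⟩ := h₁.bounded
  obtain ⟨N₂, hN₂⟩ := h₂.bounded
  refine ⟨⟨N₁ + N₂, fun t => ?_⟩, fun i => ?_⟩
  · have := natDegree_mul_le (p := q₁ t) (q := q₂ t)
    have := hN₁ t
    have := hN₂ t
    omega
  · simp only [coeff_mul, coeff_add, ← Finset.sum_add_distrib]
    exact HasDerivAt.fun_sum fun x _ => (h₁.coeff x.1).mul (h₂.coeff x.2)

theorem add (h₁ : HasPolyDerivAt q₁ r₁ τ) (h₂ : HasPolyDerivAt q₂ r₂ τ) :
    HasPolyDerivAt (fun t => q₁ t + q₂ t) (r₁ + r₂) τ := by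
  obtain ⟨N₁, hN₁⟩ := h₁.bounded
  obtain ⟨N₂, hN₂⟩ := h₂.bounded
  refine ⟨⟨max N₁ N₂, fun t => ?_⟩, fun i => ?_⟩
  · exact (natDegree_add_le _ _).trans_lt (max_lt_max (hN₁ t) (hN₂ t))
  · simpa only [coeff_add] using (h₁.coeff i).fun_add (h₂.coeff i)

theorem sub (h₁ : HasPolyDerivAt q₁ r₁ τ) (h₂ : HasPolyDerivAt q₂ r₂ τ) :
    HasPolyDerivAt (fun t => q₁ t - q₂ t) (r₁ - r₂) τ := by
  obtain ⟨N₁, hN₁⟩ := h₁.bounded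
  obtain ⟨N₂, hN₂⟩ := h₂.bounded
  refine ⟨⟨max N₁ N₂, fun t => ?_⟩, fun i => ?_⟩
  · exact (natDegree_sub_le _ _).trans_lt (max_lt_max (hN₁ t) (hN₂ t))
  · simpa only [coeff_sub] using (h₁.coeff i).fun_sub (h₂.coeff i)

theorem C_mul {f : ℝ → ℝ} {f' : ℝ} (hf : HasDerivAt f f' τ) (h : HasPolyDerivAt q r τ) :
    HasPolyDerivAt (fun t => C (f t) * q t) (C f' * q τ + C (f τ) * r) τ := by
  obtain ⟨N, hN⟩ := h.bounded
  refine ⟨⟨N, fun t => (natDegree_C_mul_le _ _).trans_lt (hN t)⟩, fun i => ?_⟩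
  simpa only [coeff_add, coeff_C_mul] using hf.fun_mul (h.coeff i)

theorem sum {Q : ℕ → ℝ → ℝ[X]} {R : ℕ → ℝ[X]} {m : ℕ}
    (h : ∀ k < m, HasPolyDerivAt (Q k) (R k) τ) :
    HasPolyDerivAt (fun t => ∑ k ∈ Finset.range m, Q k t) (∑ k ∈ Finset.range m, R k) τ := by
  induction m with
  | zero => simpa using const 0 τ
  | succ m ih =>
    simpa only [Finset.sum_range_succ] using
      (ih fun k hk => h k (by omega)).add (h m (by omega))

/-- The product rule for a differentiable family of functionals applied to a differentiable
family of polynomials. -/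
theorem map {ℓ : ℝ → ℝ[X] →ₗ[ℝ] ℝ} {ℓ' : ℝ[X] → ℝ} (h : HasPolyDerivAt q r τ)
    (hℓ : ∀ p, HasDerivAt (fun t => ℓ t p) (ℓ' p) τ) :
    HasDerivAt (fun t => ℓ t (q t)) (ℓ τ r + ℓ' (q τ)) τ := by
  obtain ⟨N, hN⟩ := h.bounded
  have hexp : ∀ (L : ℝ[X] →ₗ[ℝ] ℝ) (p : ℝ[X]), (∀ i, N ≤ i → p.coeff i = 0) →
      L p = ∑ i ∈ Finset.range N, p.coeff i * L (X ^ i) := by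
    intro L p hp
    have hd : p.degree < N := (degree_lt_iff_coeff_zero _ _).2 hp
    have e : p = ∑ i ∈ Finset.range N, C (p.coeff i) * X ^ i := by
      rcases eq_or_ne p 0 with rfl | h0
      · simp
      · exact as_sum_range_C_mul_X_pow' p ((natDegree_lt_iff_degree_lt h0).2 hd)
    conv_lhs => rw [e]
    simp only [map_sum, L.map_C_mul]
  have hq : ∀ t i, N ≤ i → (q t).coeff i = 0 := fun t i hi =>
    coeff_eq_zero_of_natDegree_lt ((hN t).trans_le hi)
  have hr : ∀ i, N ≤ i → r.coeff i = 0 := fun i hi => by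
    have h0 : HasDerivAt (fun t => (q t).coeff i) 0 τ := by
      simpa only [hq _ i hi] using hasDerivAt_const τ (0 : ℝ)
    exact (h.coeff i).unique h0
  have hsum : ∑ i ∈ Finset.range N, (q τ).coeff i * ℓ' (X ^ i) = ℓ' (q τ) := by
    refine HasDerivAt.unique ?_ (hℓ (q τ))
    simp only [fun t => hexp (ℓ t) (q τ) (hq τ)]
    exact HasDerivAt.fun_sum fun i _ => (hℓ (X ^ i)).const_mul _
  simp only [fun t => hexp (ℓ t) (q t) (hq t)]
  rw [hexp (ℓ τ) r hr, ← hsum, ← Finset.sum_add_distrib]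
  exact HasDerivAt.fun_sum fun i _ => (h.coeff i).mul (hℓ (X ^ i))

theorem eval (h : HasPolyDerivAt q r τ) {u : ℝ → ℝ} {u' : ℝ} (hu : HasDerivAt u u' τ) :
    HasDerivAt (fun t => (q t).eval (u t))
      (r.eval (u τ) + (derivative (q τ)).eval (u τ) * u') τ :=
  h.map (ℓ := fun t => Polynomial.leval (u t))
    (ℓ' := fun p => (derivative p).eval (u τ) * u') fun p => (p.hasDerivAt (u τ)).comp τ hu

end HasPolyDerivAt

/-! ### Deformation of orthogonal polynomials -/

/-- The Gram-Schmidt formula; it expresses `π_m` through `L` and the earlier polynomials, and so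
transports differentiability by induction. -/
theorem IsMonicOrthogonal.eq_X_pow_sub_sum {L : ℝ[X] →ₗ[ℝ] ℝ} {π : ℕ → ℝ[X]}
    (h : IsMonicOrthogonal L π) (m : ℕ) :
    π m = X ^ m - ∑ k ∈ Finset.range m, C (L (X ^ m * π k) / L (π k * π k)) * π k := by
  rw [← sub_eq_zero]
  refine h.eq_zero_of_map_mul (n := m) (fun k hk => ?_) fun j hj => ?_
  · rw [coeff_sub, coeff_sub, finsetSum_coeff, coeff_X_pow, if_neg hk.ne', h.coeff_of_lt hk,
      Finset.sum_eq_zero, sub_zero, sub_zero]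
    intro i hi
    rw [coeff_C_mul, h.coeff_of_lt ((Finset.mem_range.1 hi).trans hk), mul_zero]
  · rw [mul_sub, mul_sub, map_sub, map_sub, Finset.mul_sum, map_sum]
    have e : ∀ k, L (π j * (C (L (X ^ m * π k) / L (π k * π k)) * π k)) =
        L (X ^ m * π k) / L (π k * π k) * L (π j * π k) := fun k => by
      rw [mul_left_comm, L.map_C_mul]
    simp only [e]
    rcases hj.eq_or_lt with rfl | hj
    · rw [h.map_mul_eq j (q := X ^ j) fun k hk => by rw [coeff_X_pow, if_neg hk.ne'],
        Finset.sum_eq_zero fun k hk => by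
          rw [h.orthogonal j k (Finset.mem_range.1 hk).ne', mul_zero]]
      simp
    · rw [h.orthogonal j m hj.ne, Finset.sum_eq_single_of_mem j (Finset.mem_range.2 hj)
        fun k _ hk => by rw [h.orthogonal j k hk.symm, mul_zero],
        div_mul_cancel₀ _ (h.norm_pos j).ne', mul_comm (π j)]
      ring

section Deformation

variable {ℓ : ℝ → ℝ[X] →ₗ[ℝ] ℝ} {ℓ' : ℝ[X] → ℝ} {π : ℝ → ℕ → ℝ[X]} {τ : ℝ}

/-- Since the `π_m` are monic, their variation has degree less than `m`. -/
theorem exists_hasPolyDerivAt (hπ : ∀ t, IsMonicOrthogonal (ℓ t) (π t))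
    (hℓ : ∀ p, HasDerivAt (fun t => ℓ t p) (ℓ' p) τ) (m : ℕ) :
    ∃ r, HasPolyDerivAt (fun t => π t m) r τ ∧ r.degree < m := by
  have H : ∃ r, HasPolyDerivAt (fun t => π t m) r τ := by
    induction m using Nat.strong_induction_on with
    | _ m ih =>
      choose! R hR using ih
      have hc : ∀ k, k < m → ∃ c, HasDerivAt
          (fun t => ℓ t (X ^ m * π t k) / ℓ t (π t k * π t k)) c τ := fun k hk =>
        ⟨_, ((((HasPolyDerivAt.const (X ^ m) τ).mul (hR k hk)).map hℓ).div
          (((hR k hk).mul (hR k hk)).map hℓ) ((hπ τ).norm_pos k).ne')⟩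
      choose! c hc using hc
      have h := (HasPolyDerivAt.const (X ^ m) τ).sub
        (HasPolyDerivAt.sum fun k hk => (hR k hk).C_mul (hc k hk))
      have e : (fun t => π t m) = fun t => X ^ m - ∑ k ∈ Finset.range m,
          C (ℓ t (X ^ m * π t k) / ℓ t (π t k * π t k)) * π t k :=
        funext fun t => (hπ t).eq_X_pow_sub_sum m
      exact ⟨_, by rw [e]; exact h⟩
  obtain ⟨r, hr⟩ := H
  refine ⟨r, hr, (degree_lt_iff_coeff_zero _ _).2 fun k hk => ?_⟩
  refine (hr.coeff k).unique ?_
  rcases hk.eq_or_lt with rfl | hk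
  · simpa only [(hπ _).coeff_self] using hasDerivAt_const τ (1 : ℝ)
  · simpa only [(hπ _).coeff_of_lt hk] using hasDerivAt_const τ (0 : ℝ)

/-- In the derivative of a squared norm the variation of `π_m` drops out by orthogonality. -/
theorem hasDerivAt_normSq (hπ : ∀ t, IsMonicOrthogonal (ℓ t) (π t))
    (hℓ : ∀ p, HasDerivAt (fun t => ℓ t p) (ℓ' p) τ) (m : ℕ) :
    HasDerivAt (fun t => ℓ t (π t m * π t m)) (ℓ' (π τ m * π τ m)) τ := by
  obtain ⟨r, hr, hdeg⟩ := exists_hasPolyDerivAt hπ hℓ m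
  refine ((hr.mul hr).map hℓ).congr_deriv ?_
  rw [map_add, mul_comm r, (hπ τ).map_mul_eq_zero m hdeg]
  ring

/-- When `ℓ'` is the infinitesimal translation of a Gaussian-type functional, the orthogonal
polynomials seen from a point that moves along evolve by the Toda lattice. -/
theorem hasDerivAt_eval_of_translation (hπ : ∀ t, IsMonicOrthogonal (ℓ t) (π t))
    (hℓ : ∀ p, HasDerivAt (fun t => ℓ t p) (ℓ' p) τ)
    (htr : ∀ p, ℓ' p = ℓ τ (derivative p - 2 * X * p)) (m : ℕ) {u : ℝ → ℝ}
    (hu : HasDerivAt u 1 τ) :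
    HasDerivAt (fun t => (π t m).eval (u t))
      (2 * ((u τ - diagCoeff (ℓ τ) (π τ) m) * (π τ m).eval (u τ) - (π τ (m + 1)).eval (u τ))) τ := by
  have h := hπ τ
  obtain ⟨r, hr, hdeg⟩ := exists_hasPolyDerivAt hπ hℓ m
  set L := ℓ τ
  set α := diagCoeff L (π τ) m
  have hdeg' : (derivative (π τ m)).degree < m := by
    rw [degree_lt_iff_coeff_zero]
    intro k hk
    rw [coeff_derivative, h.coeff_of_lt (by omega), zero_mul]
  -- orthogonality of `π_m` and `π_j`, differentiated
  have hvar : ∀ j < m, L (π τ j * (r + derivative (π τ m))) = 2 * L (X * (π τ j * π τ m)) := by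
    intro j hj
    obtain ⟨ρ, hρ, hρdeg⟩ := exists_hasPolyDerivAt hπ hℓ j
    have h0 : HasDerivAt (fun t => ℓ t (π t m * π t j)) 0 τ := by
      simpa only [(hπ _).orthogonal m j hj.ne'] using hasDerivAt_const τ (0 : ℝ)
    have h1 := ((hr.mul hρ).map hℓ).unique h0
    have h2 : L (π τ m * ρ) = 0 :=
      h.map_mul_eq_zero m (hρdeg.trans (by exact_mod_cast hj))
    have h3 : L (π τ m * derivative (π τ j)) = 0 := by
      refine h.map_mul_eq_zero m ((degree_derivative_le).trans_lt ?_)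
      rw [degree_lt_iff_coeff_zero]
      intro k hk
      exact h.coeff_of_lt (by omega)
    have e : derivative (π τ m * π τ j) - 2 * X * (π τ m * π τ j) =
        derivative (π τ m) * π τ j + π τ m * derivative (π τ j)
          - C 2 * (X * (π τ j * π τ m)) := by
      rw [derivative_mul, show (C 2 : ℝ[X]) = 2 from rfl]; ring
    rw [htr, e, map_sub, map_add, map_add, h2, h3, L.map_C_mul, mul_comm r,
      mul_comm (derivative _)] at h1
    rw [mul_add, map_add]
    linarith
  have key : (r + derivative (π τ m)) - C 2 * ((X - C α) * π τ m - π τ (m + 1)) = 0 := by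
    refine h.eq_zero_of_map_mul (n := m) (fun k hk => ?_) fun j hj => ?_
    · rw [coeff_sub, coeff_C_mul, h.coeff_X_sub_C_mul_sub α hk, coeff_add,
        (degree_lt_iff_coeff_zero _ _).1 hdeg k hk.le,
        (degree_lt_iff_coeff_zero _ _).1 hdeg' k hk.le]
      ring
    · have e : π τ j * ((r + derivative (π τ m)) - C 2 * ((X - C α) * π τ m - π τ (m + 1))) =
          π τ j * (r + derivative (π τ m)) - C 2 * (X * (π τ j * π τ m)) +
            C 2 * (C α * (π τ j * π τ m)) + C 2 * (π τ j * π τ (m + 1)) := by ring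
      rw [e, map_add, map_add, map_sub, L.map_C_mul, L.map_C_mul, L.map_C_mul, L.map_C_mul,
        h.orthogonal j (m + 1) (by omega)]
      rcases hj.eq_or_lt with rfl | hj
      · rw [mul_add, map_add, h.map_mul_eq_zero j hdeg, h.map_mul_eq_zero j hdeg',
          h.map_X_mul_self]
        ring
      · rw [hvar j hj, h.orthogonal j m hj.ne]
        ring
  refine (hr.eval hu).congr_deriv ?_
  have := congrArg (Polynomial.eval (u τ)) key
  simp only [eval_sub, eval_add, eval_mul, eval_C, eval_X, eval_zero] at this
  linarith

end Deformation

/-! ### Identities from integration by parts -/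

section Semiclassical

/-! The hypothesis `hL` on the functional `L` is integration by parts for a Gaussian weight with
boundary terms `E₁`, `E₂` at two points `s₁`, `s₂`. -/

variable {L : ℝ[X] →ₗ[ℝ] ℝ} {π : ℕ → ℝ[X]} {E₁ E₂ s₁ s₂ : ℝ}

/-- Integration by parts against `π_m²`. -/
theorem two_mul_diagCoeff_mul (h : IsMonicOrthogonal L π)
    (hL : ∀ p, L (derivative p - 2 * X * p) = -(E₁ * p.eval s₁ + E₂ * p.eval s₂)) (m : ℕ) :
    2 * (diagCoeff L π m * L (π m * π m)) =
      E₁ * (π m).eval s₁ ^ 2 + E₂ * (π m).eval s₂ ^ 2 := by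
  have hd : L (π m * derivative (π m)) = 0 := h.map_mul_eq_zero m <| by
    rw [degree_lt_iff_coeff_zero]
    intro k hk
    rw [coeff_derivative, h.coeff_of_lt (by omega), zero_mul]
  have h1 := hL (π m * π m)
  have e : derivative (π m * π m) - 2 * X * (π m * π m) =
      C 2 * (π m * derivative (π m)) - C 2 * (X * (π m * π m)) := by
    rw [derivative_mul, show (C 2 : ℝ[X]) = 2 from rfl]; ring
  rw [e, map_sub, L.map_C_mul, L.map_C_mul, hd, h.map_X_mul_self, eval_mul, eval_mul] at h1
  linarith

theorem map_mul_derivative_succ (h : IsMonicOrthogonal L π) (m : ℕ) :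
    L (π m * derivative (π (m + 1))) = (m + 1) * L (π m * π m) := by
  rw [h.map_mul_eq m, coeff_derivative, h.coeff_self, one_mul]
  intro k hk
  rw [coeff_derivative, h.coeff_of_lt (by omega), zero_mul]

/-- Integration by parts against `π_{m+1} π_m`. -/
theorem two_mul_normSq_succ (h : IsMonicOrthogonal L π)
    (hL : ∀ p, L (derivative p - 2 * X * p) = -(E₁ * p.eval s₁ + E₂ * p.eval s₂)) (m : ℕ) :
    2 * L (π (m + 1) * π (m + 1)) = (m + 1) * L (π m * π m) +
      (E₁ * ((π (m + 1)).eval s₁ * (π m).eval s₁) +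
        E₂ * ((π (m + 1)).eval s₂ * (π m).eval s₂)) := by
  have hd : L (π (m + 1) * derivative (π m)) = 0 := h.map_mul_eq_zero _ <| by
    rw [degree_lt_iff_coeff_zero]
    intro k hk
    rw [coeff_derivative, h.coeff_of_lt (by omega), zero_mul]
  have h1 := hL (π (m + 1) * π m)
  have e : derivative (π (m + 1) * π m) - 2 * X * (π (m + 1) * π m) =
      π m * derivative (π (m + 1)) + π (m + 1) * derivative (π m)
        - C 2 * (X * (π m * π (m + 1))) := by
    rw [derivative_mul, show (C 2 : ℝ[X]) = 2 from rfl]; ring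
  rw [e, map_sub, map_add, L.map_C_mul, hd, h.map_X_mul_succ, map_mul_derivative_succ h, eval_mul,
    eval_mul] at h1
  linarith

/-- Integration by parts against `t π_{m+1} π_m`. -/
theorem sum_mul_eval_mul_eval (h : IsMonicOrthogonal L π)
    (hL : ∀ p, L (derivative p - 2 * X * p) = -(E₁ * p.eval s₁ + E₂ * p.eval s₂)) (m : ℕ) :
    E₁ * (s₁ * ((π (m + 1)).eval s₁ * (π m).eval s₁)) +
        E₂ * (s₂ * ((π (m + 1)).eval s₂ * (π m).eval s₂)) =
      (π (m + 1)).coeff m * L (π m * π m) +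
        2 * (diagCoeff L π (m + 1) + diagCoeff L π m) * L (π (m + 1) * π (m + 1)) := by
  have h1 := hL (X * (π (m + 1) * π m))
  set α := diagCoeff L π (m + 1)
  set β := L (π (m + 1) * π (m + 1)) / L (π m * π m) with hβ
  -- the Euler operator acts on `π_{m+1}` as `m + 1` up to the second coefficient
  have hE : L (π m * (X * derivative (π (m + 1)) - C ((m : ℝ) + 1) * π (m + 1))) =
      -(π (m + 1)).coeff m * L (π m * π m) := by
    have hco : ∀ k : ℕ, (X * derivative (π (m + 1)) - C ((m : ℝ) + 1) * π (m + 1)).coeff k =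
        ((k : ℝ) - (m + 1)) * (π (m + 1)).coeff k := by
      intro k
      rw [coeff_sub, coeff_C_mul]
      cases k with
      | zero => simp; ring
      | succ k => rw [coeff_X_mul, coeff_derivative]; push_cast; ring
    rw [h.map_mul_eq m, hco]
    · ring
    · intro k hk
      rw [hco]
      rcases (Nat.succ_le_iff.2 hk).eq_or_lt with rfl | hk
      · push_cast; ring
      · rw [h.coeff_of_lt hk, mul_zero]
  have hE' : L (π m * (X * derivative (π (m + 1)))) = -(π (m + 1)).coeff m * L (π m * π m) := by
    have e : π m * (X * derivative (π (m + 1))) =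
        π m * (X * derivative (π (m + 1)) - C ((m : ℝ) + 1) * π (m + 1)) +
          C ((m : ℝ) + 1) * (π m * π (m + 1)) := by ring
    rw [e, map_add, hE, L.map_C_mul, h.orthogonal m (m + 1) (by omega)]
    ring
  have hD : L (π (m + 1) * (X * derivative (π m))) = 0 := h.map_mul_eq_zero _ <| by
    rw [degree_lt_iff_coeff_zero]
    intro k hk
    obtain ⟨k, rfl⟩ : ∃ i, k = i + 1 := ⟨k - 1, by omega⟩
    rw [coeff_X_mul, coeff_derivative, h.coeff_of_lt (by omega), zero_mul]
  have hX : L (X * (X * (π (m + 1) * π m))) =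
      (α + diagCoeff L π m) * L (π (m + 1) * π (m + 1)) := by
    have e : X * (X * (π (m + 1) * π m)) =
        X * (π m * π (m + 2)) + C α * (X * (π m * π (m + 1))) + C β * (X * (π m * π m)) := by
      rw [show X * (X * (π (m + 1) * π m)) = X * π m * (X * π (m + 1)) by ring, h.recurrence m]
      ring
    rw [e, map_add, map_add, L.map_C_mul, L.map_C_mul, h.map_X_mul_of_lt (by omega),
      h.map_X_mul_succ, h.map_X_mul_self, hβ]
    have := (h.norm_pos m).ne'
    field_simp
    ring
  have e : derivative (X * (π (m + 1) * π m)) - 2 * X * (X * (π (m + 1) * π m)) =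
      π (m + 1) * π m + π m * (X * derivative (π (m + 1))) + π (m + 1) * (X * derivative (π m))
        - C 2 * (X * (X * (π (m + 1) * π m))) := by
    rw [derivative_mul, derivative_mul, derivative_X, show (C 2 : ℝ[X]) = 2 from rfl]; ring
  rw [e, map_sub, map_add, map_add, L.map_C_mul, h.orthogonal (m + 1) m (by omega), hE', hD, hX]
    at h1
  simp only [eval_mul, eval_X] at h1
  linarith

end Semiclassical

/-! ### The Gaussian weight with two jumps -/

section JumpWeight

/-- The squared norm `γ_m⁻² = ∫ π_m² w`. -/
noncomputable def jumpNormSq (ω₁ ω₂ : ℝ) (m : ℕ) (s₁ s₂ : ℝ) : ℝ :=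
  jumpFunctional ω₁ ω₂ s₁ s₂ (jumpOP ω₁ ω₂ m s₁ s₂ * jumpOP ω₁ ω₂ m s₁ s₂)

variable {ω₁ ω₂ : ℝ}

theorem isMonicOrthogonal_jumpOP (hω₁ : 0 ≤ ω₁) (hω₂ : 0 ≤ ω₂) (s₁ s₂ : ℝ) :
    IsMonicOrthogonal (jumpFunctional ω₁ ω₂ s₁ s₂) fun m => jumpOP ω₁ ω₂ m s₁ s₂ :=
  isMonicOrthogonal_monicOrthPoly (fun _ => rfl) fun _ hp => jumpFunctional_sq_pos hω₁ hω₂ s₁ s₂ hp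

theorem jumpNormSq_pos (hω₁ : 0 ≤ ω₁) (hω₂ : 0 ≤ ω₂) (m : ℕ) (s₁ s₂ : ℝ) :
    0 < jumpNormSq ω₁ ω₂ m s₁ s₂ :=
  (isMonicOrthogonal_jumpOP hω₁ hω₂ s₁ s₂).norm_pos m

theorem jumpGamma_eq (ω₁ ω₂ : ℝ) (m : ℕ) (s₁ s₂ : ℝ) :
    jumpGamma ω₁ ω₂ m s₁ s₂ = (Real.sqrt (jumpNormSq ω₁ ω₂ m s₁ s₂))⁻¹ := by
  simp only [jumpGamma, jumpNormSq, jumpFunctional_apply, eval_mul, sq]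

theorem jumpGamma_sq (hω₁ : 0 ≤ ω₁) (hω₂ : 0 ≤ ω₂) (m : ℕ) (s₁ s₂ : ℝ) :
    jumpGamma ω₁ ω₂ m s₁ s₂ ^ 2 = (jumpNormSq ω₁ ω₂ m s₁ s₂)⁻¹ := by
  rw [jumpGamma_eq, inv_pow, Real.sq_sqrt (jumpNormSq_pos hω₁ hω₂ m s₁ s₂).le]

theorem jumpGamma_pos (hω₁ : 0 ≤ ω₁) (hω₂ : 0 ≤ ω₂) (m : ℕ) (s₁ s₂ : ℝ) :
    0 < jumpGamma ω₁ ω₂ m s₁ s₂ := by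
  rw [jumpGamma_eq]
  exact inv_pos.2 (Real.sqrt_pos.2 (jumpNormSq_pos hω₁ hω₂ m s₁ s₂))

theorem jumpAlpha_eq (ω₁ ω₂ : ℝ) (m : ℕ) (s₁ s₂ : ℝ) :
    jumpAlpha ω₁ ω₂ m s₁ s₂ =
      diagCoeff (jumpFunctional ω₁ ω₂ s₁ s₂) (fun m => jumpOP ω₁ ω₂ m s₁ s₂) m := by
  simp only [jumpAlpha, diagCoeff, jumpFunctional_apply, eval_mul, eval_X, sq]

theorem jumpBeta_sq (hω₁ : 0 ≤ ω₁) (hω₂ : 0 ≤ ω₂) (m : ℕ) (s₁ s₂ : ℝ) :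
    jumpBeta ω₁ ω₂ (m + 1) s₁ s₂ ^ 2 =
      jumpNormSq ω₁ ω₂ (m + 1) s₁ s₂ / jumpNormSq ω₁ ω₂ m s₁ s₂ := by
  rw [jumpBeta, div_pow, jumpGamma_sq hω₁ hω₂, jumpGamma_sq hω₁ hω₂, Nat.add_sub_cancel,
    inv_div_inv]

theorem hankelDet_eq_prod (hω₁ : 0 ≤ ω₁) (hω₂ : 0 ≤ ω₂) (n : ℕ) (s₁ s₂ : ℝ) :
    hankelDet ω₁ ω₂ n s₁ s₂ = ∏ m ∈ Finset.range n, jumpNormSq ω₁ ω₂ m s₁ s₂ := by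
  have h := (isMonicOrthogonal_jumpOP hω₁ hω₂ s₁ s₂).det_hankel n
  simpa only [hankelDet, jumpNormSq, jumpFunctional_apply ω₁ ω₂ s₁ s₂ (X ^ _), eval_pow, eval_X]
    using h

/-- Derivative of `ln D_n` along an arbitrary motion of the jumps; the partial derivatives in `s₁`
and `s₂` are the cases where one jump stays fixed. -/
theorem hasDerivAt_log_hankelDet (hω₁ : 0 ≤ ω₁) (hω₂ : 0 ≤ ω₂) (n : ℕ) {σ₁ σ₂ : ℝ → ℝ}
    {τ d₁ d₂ : ℝ} (h₁ : HasDerivAt σ₁ d₁ τ) (h₂ : HasDerivAt σ₂ d₂ τ) (hs : σ₁ τ < σ₂ τ) :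
    HasDerivAt (fun t => Real.log (hankelDet ω₁ ω₂ n (σ₁ t) (σ₂ t)))
      (∑ m ∈ Finset.range n,
        -(jumpMass (ω₁ - 1) (σ₁ τ) * d₁ * (jumpOP ω₁ ω₂ m (σ₁ τ) (σ₂ τ)).eval (σ₁ τ) ^ 2 +
          jumpMass (ω₂ - ω₁) (σ₂ τ) * d₂ * (jumpOP ω₁ ω₂ m (σ₁ τ) (σ₂ τ)).eval (σ₂ τ) ^ 2) /
            jumpNormSq ω₁ ω₂ m (σ₁ τ) (σ₂ τ)) τ := by
  have e : ∀ t, Real.log (hankelDet ω₁ ω₂ n (σ₁ t) (σ₂ t)) =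
      ∑ m ∈ Finset.range n, Real.log (jumpNormSq ω₁ ω₂ m (σ₁ t) (σ₂ t)) := fun t => by
    rw [hankelDet_eq_prod hω₁ hω₂,
      Real.log_prod fun m _ => (jumpNormSq_pos hω₁ hω₂ m _ _).ne']
  simp only [e]
  refine HasDerivAt.fun_sum fun m _ => ?_
  have h := hasDerivAt_normSq (fun t => isMonicOrthogonal_jumpOP hω₁ hω₂ (σ₁ t) (σ₂ t))
    (fun p => hasDerivAt_jumpFunctional ω₁ ω₂ h₁ h₂ hs p) m
  simp only [eval_mul] at h
  simp only [sq]
  exact h.log (jumpNormSq_pos hω₁ hω₂ m _ _).ne'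

theorem two_mul_jumpAlpha_mul (hω₁ : 0 ≤ ω₁) (hω₂ : 0 ≤ ω₂) (m : ℕ) {s₁ s₂ : ℝ} (hs : s₁ < s₂) :
    2 * (jumpAlpha ω₁ ω₂ m s₁ s₂ * jumpNormSq ω₁ ω₂ m s₁ s₂) =
      jumpMass (ω₁ - 1) s₁ * (jumpOP ω₁ ω₂ m s₁ s₂).eval s₁ ^ 2 +
        jumpMass (ω₂ - ω₁) s₂ * (jumpOP ω₁ ω₂ m s₁ s₂).eval s₂ ^ 2 := by
  rw [jumpAlpha_eq]
  exact two_mul_diagCoeff_mul (isMonicOrthogonal_jumpOP hω₁ hω₂ s₁ s₂)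
    (jumpFunctional_derivative_sub ω₁ ω₂ hs.le) m

/-- `F = -2 ∑_{m < n} α_m`: the two partial derivatives of `ln D_n = ∑ ln h_m` add up to the
boundary terms of the integration by parts that computes `α_m`. -/
theorem hankelLogDeriv_eq (hω₁ : 0 ≤ ω₁) (hω₂ : 0 ≤ ω₂) (n : ℕ) {s₁ s₂ : ℝ} (hs : s₁ < s₂) :
    hankelLogDeriv ω₁ ω₂ n s₁ s₂ = -2 * ∑ m ∈ Finset.range n, jumpAlpha ω₁ ω₂ m s₁ s₂ := by
  have h₁ := hasDerivAt_log_hankelDet hω₁ hω₂ n (hasDerivAt_id s₁) (hasDerivAt_const s₁ s₂) hs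
  have h₂ := hasDerivAt_log_hankelDet hω₁ hω₂ n (hasDerivAt_const s₂ s₁) (hasDerivAt_id s₂) hs
  simp only [id] at h₁ h₂
  rw [hankelLogDeriv, h₁.deriv, h₂.deriv, ← Finset.sum_add_distrib, Finset.mul_sum]
  refine Finset.sum_congr rfl fun m _ => ?_
  rw [← add_div, div_eq_iff (jumpNormSq_pos hω₁ hω₂ m s₁ s₂).ne']
  linarith [two_mul_jumpAlpha_mul hω₁ hω₂ m hs]

/-! ### Translation of the two jumps -/

variable {s : ℝ}

/-- For a rigid translation of the jumps, the derivative of the functional and integration by parts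
have the same boundary terms. -/
theorem hasDerivAt_jumpFunctional_translate (ω₁ ω₂ : ℝ) (hs : 0 < s) (x : ℝ) (p : ℝ[X]) :
    HasDerivAt (fun t => jumpFunctional ω₁ ω₂ (t - s) (t + s) p)
      (jumpFunctional ω₁ ω₂ (x - s) (x + s) (derivative p - 2 * X * p)) x := by
  have h := hasDerivAt_jumpFunctional ω₁ ω₂ ((hasDerivAt_id x).sub_const s)
    ((hasDerivAt_id x).add_const s) (by simp only [id]; linarith) p
  rw [jumpFunctional_derivative_sub ω₁ ω₂ (by linarith)]
  simpa only [id, mul_one] using h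

theorem hasDerivAt_eval_jumpOP (hω₁ : 0 ≤ ω₁) (hω₂ : 0 ≤ ω₂) (hs : 0 < s) (m : ℕ) {x : ℝ}
    {u : ℝ → ℝ} (hu : HasDerivAt u 1 x) :
    HasDerivAt (fun t => (jumpOP ω₁ ω₂ m (t - s) (t + s)).eval (u t))
      (2 * ((u x - jumpAlpha ω₁ ω₂ m (x - s) (x + s)) *
          (jumpOP ω₁ ω₂ m (x - s) (x + s)).eval (u x) -
        (jumpOP ω₁ ω₂ (m + 1) (x - s) (x + s)).eval (u x))) x := by
  rw [jumpAlpha_eq]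
  exact hasDerivAt_eval_of_translation
    (fun t => isMonicOrthogonal_jumpOP hω₁ hω₂ (t - s) (t + s))
    (hasDerivAt_jumpFunctional_translate ω₁ ω₂ hs x) (fun _ => rfl) m hu

theorem hasDerivAt_jumpNormSq (hω₁ : 0 ≤ ω₁) (hω₂ : 0 ≤ ω₂) (hs : 0 < s) (m : ℕ) (x : ℝ) :
    HasDerivAt (fun t => jumpNormSq ω₁ ω₂ m (t - s) (t + s))
      (-2 * jumpAlpha ω₁ ω₂ m (x - s) (x + s) * jumpNormSq ω₁ ω₂ m (x - s) (x + s)) x := by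
  refine (hasDerivAt_normSq (fun t => isMonicOrthogonal_jumpOP hω₁ hω₂ (t - s) (t + s))
    (hasDerivAt_jumpFunctional_translate ω₁ ω₂ hs x) m).congr_deriv ?_
  have h := two_mul_jumpAlpha_mul hω₁ hω₂ m (show x - s < x + s by linarith)
  rw [jumpFunctional_derivative_sub ω₁ ω₂ (by linarith), eval_mul, eval_mul]
  linarith

/-- The other form of the Toda flow, with the three-term recurrence inserted. -/
theorem hasDerivAt_eval_jumpOP_succ (hω₁ : 0 ≤ ω₁) (hω₂ : 0 ≤ ω₂) (hs : 0 < s) (m : ℕ) {x : ℝ}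
    {u : ℝ → ℝ} (hu : HasDerivAt u 1 x) :
    HasDerivAt (fun t => (jumpOP ω₁ ω₂ (m + 1) (t - s) (t + s)).eval (u t))
      (2 * (jumpNormSq ω₁ ω₂ (m + 1) (x - s) (x + s) / jumpNormSq ω₁ ω₂ m (x - s) (x + s)) *
        (jumpOP ω₁ ω₂ m (x - s) (x + s)).eval (u x)) x := by
  refine (hasDerivAt_eval_jumpOP hω₁ hω₂ hs (m + 1) hu).congr_deriv ?_
  have h := congrArg (eval (u x))
    ((isMonicOrthogonal_jumpOP hω₁ hω₂ (x - s) (x + s)).recurrence m)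
  simp only [eval_mul, eval_add, eval_X, eval_C] at h
  rw [jumpAlpha_eq]
  simp only [jumpNormSq]
  linarith

theorem continuous_eval_jumpOP (hω₁ : 0 ≤ ω₁) (hω₂ : 0 ≤ ω₂) (hs : 0 < s) (m : ℕ) (e : ℝ) :
    Continuous fun t => (jumpOP ω₁ ω₂ m (t - s) (t + s)).eval (t + e) :=
  continuous_iff_continuousAt.2 fun x =>
    (hasDerivAt_eval_jumpOP hω₁ hω₂ hs m ((hasDerivAt_id x).add_const e)).continuousAt

theorem continuous_jumpNormSq (hω₁ : 0 ≤ ω₁) (hω₂ : 0 ≤ ω₂) (hs : 0 < s) (m : ℕ) :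
    Continuous fun t => jumpNormSq ω₁ ω₂ m (t - s) (t + s) :=
  continuous_iff_continuousAt.2 fun x => (hasDerivAt_jumpNormSq hω₁ hω₂ hs m x).continuousAt

theorem continuous_jumpAlpha (hω₁ : 0 ≤ ω₁) (hω₂ : 0 ≤ ω₂) (hs : 0 < s) (m : ℕ) :
    Continuous fun t => jumpAlpha ω₁ ω₂ m (t - s) (t + s) := by
  have hne : ∀ t, 2 * jumpNormSq ω₁ ω₂ m (t - s) (t + s) ≠ 0 := fun t =>
    mul_ne_zero two_ne_zero (jumpNormSq_pos hω₁ hω₂ m _ _).ne'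
  have e : ∀ t, jumpAlpha ω₁ ω₂ m (t - s) (t + s) =
      (jumpMass (ω₁ - 1) (t + -s) * (jumpOP ω₁ ω₂ m (t - s) (t + s)).eval (t + -s) ^ 2 +
        jumpMass (ω₂ - ω₁) (t + s) * (jumpOP ω₁ ω₂ m (t - s) (t + s)).eval (t + s) ^ 2) /
      (2 * jumpNormSq ω₁ ω₂ m (t - s) (t + s)) := fun t => by
    rw [eq_div_iff (hne t), ← sub_eq_add_neg,
      ← two_mul_jumpAlpha_mul hω₁ hω₂ m (show t - s < t + s by linarith)]
    ring
  simp only [e]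
  have h1 := continuous_eval_jumpOP hω₁ hω₂ hs m (-s)
  have h2 := continuous_eval_jumpOP hω₁ hω₂ hs m s
  have h3 := continuous_jumpNormSq hω₁ hω₂ hs m
  refine Continuous.div ?_ (by fun_prop) hne
  simp only [jumpMass]
  fun_prop

/-- The zeros of `x ↦ π_m(x + e)` are simple, hence isolated: at a zero the derivative is
`-2 π_{m+1}(x + e)`. -/
theorem eventually_eval_jumpOP_ne_zero (hω₁ : 0 ≤ ω₁) (hω₂ : 0 ≤ ω₂) (hs : 0 < s) (m : ℕ)
    (e x : ℝ) : ∀ᶠ t in 𝓝[≠] x, (jumpOP ω₁ ω₂ m (t - s) (t + s)).eval (t + e) ≠ 0 := by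
  by_cases h0 : (jumpOP ω₁ ω₂ m (x - s) (x + s)).eval (x + e) = 0
  · have hd := hasDerivAt_eval_jumpOP hω₁ hω₂ hs m ((hasDerivAt_id x).add_const e)
    refine hd.eventually_ne ?_
    simp only [id, h0, mul_zero, zero_sub]
    exact mul_ne_zero two_ne_zero (neg_ne_zero.2
      ((isMonicOrthogonal_jumpOP hω₁ hω₂ (x - s) (x + s)).eval_succ_ne_zero h0))
  · exact ((continuous_eval_jumpOP hω₁ hω₂ hs m e).continuousAt.eventually_ne h0).filter_mono
      nhdsWithin_le_nhds

theorem eqUpToRemovable_of_continuous {E : Type} [TopologicalSpace E] {P : Set ℝ} {f g : ℝ → E}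
    (hP : ∀ x : ℝ, ∀ᶠ t in 𝓝[≠] x, t ∉ P) (hg : Continuous g) (h : ∀ x, x ∉ P → f x = g x) :
    EqUpToRemovable P f g := by
  refine ⟨h, fun x _ => ((hg.tendsto x).mono_left nhdsWithin_le_nhds).congr' ?_⟩
  filter_upwards [hP x] with t ht
  exact (h t ht).symm

/-! ### The solution of the coupled Painlevé IV system -/

/-- The function `a_k = c e^{-u²} π_m(u)² / (2 h_m)`, where `u` is the `k`-th jump point, `c` the
relative height of the jump there, and `n = m + 1`. -/
noncomputable def pivA (ω₁ ω₂ : ℝ) (m : ℕ) (c s₁ s₂ u : ℝ) : ℝ :=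
  jumpMass c u * (jumpOP ω₁ ω₂ m s₁ s₂).eval u ^ 2 / (2 * jumpNormSq ω₁ ω₂ m s₁ s₂)

/-- The function `b_k = 2 π_{m+1}(u) / π_m(u)`, where `u` is the `k`-th jump point and
`n = m + 1`. -/
noncomputable def pivB (ω₁ ω₂ : ℝ) (m : ℕ) (s₁ s₂ u : ℝ) : ℝ :=
  2 * (jumpOP ω₁ ω₂ (m + 1) s₁ s₂).eval u / (jumpOP ω₁ ω₂ m s₁ s₂).eval u

/-- The function `y = 4 π i e^{-x²} / h_m`, with `n = m + 1`. -/
noncomputable def pivY (ω₁ ω₂ : ℝ) (m : ℕ) (x s : ℝ) : ℂ :=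
  4 * Real.pi * Complex.I * ((Real.exp (-x ^ 2) / jumpNormSq ω₁ ω₂ m (x - s) (x + s) : ℝ) : ℂ)

theorem pivA_add_pivA (hω₁ : 0 ≤ ω₁) (hω₂ : 0 ≤ ω₂) (m : ℕ) {s₁ s₂ : ℝ} (hs : s₁ < s₂) :
    pivA ω₁ ω₂ m (ω₁ - 1) s₁ s₂ s₁ + pivA ω₁ ω₂ m (ω₂ - ω₁) s₁ s₂ s₂ =
      jumpAlpha ω₁ ω₂ m s₁ s₂ := by
  have h0 := (jumpNormSq_pos hω₁ hω₂ m s₁ s₂).ne'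
  rw [pivA, pivA, ← add_div, ← two_mul_jumpAlpha_mul hω₁ hω₂ m hs, div_eq_iff (by positivity)]
  ring

theorem pivA_mul_pivB (ω₁ ω₂ : ℝ) (m : ℕ) (c : ℝ) {s₁ s₂ u : ℝ}
    (hu : (jumpOP ω₁ ω₂ m s₁ s₂).eval u ≠ 0) :
    pivA ω₁ ω₂ m c s₁ s₂ u * pivB ω₁ ω₂ m s₁ s₂ u =
      jumpMass c u * ((jumpOP ω₁ ω₂ (m + 1) s₁ s₂).eval u * (jumpOP ω₁ ω₂ m s₁ s₂).eval u) /
        jumpNormSq ω₁ ω₂ m s₁ s₂ := by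
  rw [pivA, pivB]
  field_simp

theorem pivA_mul_pivB_sq (ω₁ ω₂ : ℝ) (m : ℕ) (c : ℝ) {s₁ s₂ u : ℝ}
    (hu : (jumpOP ω₁ ω₂ m s₁ s₂).eval u ≠ 0) :
    pivA ω₁ ω₂ m c s₁ s₂ u * pivB ω₁ ω₂ m s₁ s₂ u ^ 2 =
      2 * (jumpMass c u * (jumpOP ω₁ ω₂ (m + 1) s₁ s₂).eval u ^ 2) /
        jumpNormSq ω₁ ω₂ m s₁ s₂ := by
  rw [pivA, pivB]
  field_simp

theorem sum_pivA_mul_pivB (hω₁ : 0 ≤ ω₁) (hω₂ : 0 ≤ ω₂) (m : ℕ) {s₁ s₂ : ℝ} (hs : s₁ < s₂)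
    (hu₁ : (jumpOP ω₁ ω₂ m s₁ s₂).eval s₁ ≠ 0) (hu₂ : (jumpOP ω₁ ω₂ m s₁ s₂).eval s₂ ≠ 0) :
    pivA ω₁ ω₂ m (ω₁ - 1) s₁ s₂ s₁ * pivB ω₁ ω₂ m s₁ s₂ s₁ +
        pivA ω₁ ω₂ m (ω₂ - ω₁) s₁ s₂ s₂ * pivB ω₁ ω₂ m s₁ s₂ s₂ + ((m + 1 : ℕ) : ℝ) =
      2 * (jumpNormSq ω₁ ω₂ (m + 1) s₁ s₂ / jumpNormSq ω₁ ω₂ m s₁ s₂) := by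
  have h0 := (jumpNormSq_pos hω₁ hω₂ m s₁ s₂).ne'
  have h : 2 * jumpNormSq ω₁ ω₂ (m + 1) s₁ s₂ = _ :=
    two_mul_normSq_succ (isMonicOrthogonal_jumpOP hω₁ hω₂ s₁ s₂)
      (jumpFunctional_derivative_sub ω₁ ω₂ hs.le) m
  rw [pivA_mul_pivB _ _ _ _ hu₁, pivA_mul_pivB _ _ _ _ hu₂, ← mul_div_assoc, h,
    show jumpFunctional ω₁ ω₂ s₁ s₂ (jumpOP ω₁ ω₂ m s₁ s₂ * jumpOP ω₁ ω₂ m s₁ s₂) =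
      jumpNormSq ω₁ ω₂ m s₁ s₂ from rfl]
  field_simp
  push_cast
  ring

theorem sum_pivA_mul_pivB_sq (hω₁ : 0 ≤ ω₁) (hω₂ : 0 ≤ ω₂) (m : ℕ) {s₁ s₂ : ℝ} (hs : s₁ < s₂)
    (hu₁ : (jumpOP ω₁ ω₂ m s₁ s₂).eval s₁ ≠ 0) (hu₂ : (jumpOP ω₁ ω₂ m s₁ s₂).eval s₂ ≠ 0) :
    pivA ω₁ ω₂ m (ω₁ - 1) s₁ s₂ s₁ * pivB ω₁ ω₂ m s₁ s₂ s₁ ^ 2 +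
        pivA ω₁ ω₂ m (ω₂ - ω₁) s₁ s₂ s₂ * pivB ω₁ ω₂ m s₁ s₂ s₂ ^ 2 =
      4 * jumpAlpha ω₁ ω₂ (m + 1) s₁ s₂ *
        (jumpNormSq ω₁ ω₂ (m + 1) s₁ s₂ / jumpNormSq ω₁ ω₂ m s₁ s₂) := by
  rw [pivA_mul_pivB_sq _ _ _ _ hu₁, pivA_mul_pivB_sq _ _ _ _ hu₂, ← add_div, ← mul_add,
    ← two_mul_jumpAlpha_mul hω₁ hω₂ (m + 1) hs]
  ring

/-- Both sides equal twice the second coefficient of `π_n`: on the left through integration by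
parts against `t π_n π_{n-1}`, on the right through `F = -2 ∑ α_j`. -/
theorem hamiltonianIV_eq_hankelLogDeriv (hω₁ : 0 ≤ ω₁) (hω₂ : 0 ≤ ω₂) (m : ℕ) (hs : 0 < s) {x : ℝ}
    (hu₁ : (jumpOP ω₁ ω₂ m (x - s) (x + s)).eval (x - s) ≠ 0)
    (hu₂ : (jumpOP ω₁ ω₂ m (x - s) (x + s)).eval (x + s) ≠ 0) :
    hamiltonianIV (m + 1) (pivA ω₁ ω₂ m (ω₁ - 1) (x - s) (x + s) (x - s))
        (pivA ω₁ ω₂ m (ω₂ - ω₁) (x - s) (x + s) (x + s))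
        (pivB ω₁ ω₂ m (x - s) (x + s) (x - s)) (pivB ω₁ ω₂ m (x - s) (x + s) (x + s)) x s
        - 2 * (m + 1 : ℕ) * x =
      hankelLogDeriv ω₁ ω₂ (m + 1) (x - s) (x + s) := by
  have hlt : x - s < x + s := by linarith
  have h0 := (jumpNormSq_pos hω₁ hω₂ m (x - s) (x + s)).ne'
  have hπ := isMonicOrthogonal_jumpOP hω₁ hω₂ (x - s) (x + s)
  have hA := pivA_add_pivA hω₁ hω₂ m hlt
  have hS := sum_pivA_mul_pivB hω₁ hω₂ m hlt hu₁ hu₂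
  have hT := sum_pivA_mul_pivB_sq hω₁ hω₂ m hlt hu₁ hu₂
  have hF : hankelLogDeriv ω₁ ω₂ (m + 1) (x - s) (x + s) =
      2 * (jumpOP ω₁ ω₂ (m + 1) (x - s) (x + s)).coeff m := by
    rw [hankelLogDeriv_eq hω₁ hω₂ (m + 1) hlt, hπ.coeff_pred m]
    simp only [jumpAlpha_eq]
    ring
  have hU : pivA ω₁ ω₂ m (ω₁ - 1) (x - s) (x + s) (x - s) *
        pivB ω₁ ω₂ m (x - s) (x + s) (x - s) * (x - s) +
      pivA ω₁ ω₂ m (ω₂ - ω₁) (x - s) (x + s) (x + s) *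
        pivB ω₁ ω₂ m (x - s) (x + s) (x + s) * (x + s) =
      (jumpOP ω₁ ω₂ (m + 1) (x - s) (x + s)).coeff m +
        2 * (jumpAlpha ω₁ ω₂ (m + 1) (x - s) (x + s) + jumpAlpha ω₁ ω₂ m (x - s) (x + s)) *
          (jumpNormSq ω₁ ω₂ (m + 1) (x - s) (x + s) / jumpNormSq ω₁ ω₂ m (x - s) (x + s)) := by
    have hB := sum_mul_eval_mul_eval hπ (jumpFunctional_derivative_sub ω₁ ω₂ hlt.le) m
    rw [← jumpAlpha_eq, ← jumpAlpha_eq] at hB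
    change _ = _ * jumpNormSq ω₁ ω₂ m (x - s) (x + s) +
      _ * jumpNormSq ω₁ ω₂ (m + 1) (x - s) (x + s) at hB
    rw [pivA_mul_pivB _ _ _ _ hu₁, pivA_mul_pivB _ _ _ _ hu₂]
    field_simp
    linarith
  simp only [hamiltonianIV]
  push_cast at hS ⊢
  linear_combination (-2 * (pivA ω₁ ω₂ m (ω₁ - 1) (x - s) (x + s) (x - s) +
    pivA ω₁ ω₂ m (ω₂ - ω₁) (x - s) (x + s) (x + s))) * hS -
    4 * (jumpNormSq ω₁ ω₂ (m + 1) (x - s) (x + s) / jumpNormSq ω₁ ω₂ m (x - s) (x + s)) * hA +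
    2 * hU - hT - hF

theorem hasDerivAt_pivA (hω₁ : 0 ≤ ω₁) (hω₂ : 0 ≤ ω₂) (hs : 0 < s) (m : ℕ) (c : ℝ) {x : ℝ}
    {u : ℝ → ℝ} (hu : HasDerivAt u 1 x)
    (h0 : (jumpOP ω₁ ω₂ m (x - s) (x + s)).eval (u x) ≠ 0) :
    HasDerivAt (fun t => pivA ω₁ ω₂ m c (t - s) (t + s) (u t))
      (-2 * pivA ω₁ ω₂ m c (x - s) (x + s) (u x) * (jumpAlpha ω₁ ω₂ m (x - s) (x + s) +
        pivB ω₁ ω₂ m (x - s) (x + s) (u x) - u x)) x := by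
  have hN := (jumpNormSq_pos hω₁ hω₂ m (x - s) (x + s)).ne'
  have h1 := ((hu.fun_pow 2).fun_neg.exp.const_mul c).fun_mul
    ((hasDerivAt_eval_jumpOP hω₁ hω₂ hs m hu).fun_pow 2)
  refine (h1.fun_div ((hasDerivAt_jumpNormSq hω₁ hω₂ hs m x).const_mul 2)
    (mul_ne_zero two_ne_zero hN)).congr_deriv ?_
  simp only [pivA, pivB, jumpMass]
  push_cast
  field_simp
  ring

theorem hasDerivAt_pivB (hω₁ : 0 ≤ ω₁) (hω₂ : 0 ≤ ω₂) (hs : 0 < s) (m : ℕ) {x : ℝ}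
    {u : ℝ → ℝ} (hu : HasDerivAt u 1 x)
    (h0 : (jumpOP ω₁ ω₂ m (x - s) (x + s)).eval (u x) ≠ 0) :
    HasDerivAt (fun t => pivB ω₁ ω₂ m (t - s) (t + s) (u t))
      (pivB ω₁ ω₂ m (x - s) (x + s) (u x) ^ 2 + 2 * pivB ω₁ ω₂ m (x - s) (x + s) (u x) *
          (jumpAlpha ω₁ ω₂ m (x - s) (x + s) - u x) +
        4 * (jumpNormSq ω₁ ω₂ (m + 1) (x - s) (x + s) /
          jumpNormSq ω₁ ω₂ m (x - s) (x + s))) x := by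
  refine (((hasDerivAt_eval_jumpOP_succ hω₁ hω₂ hs m hu).const_mul 2).fun_div
    (hasDerivAt_eval_jumpOP hω₁ hω₂ hs m hu) h0).congr_deriv ?_
  have hN := (jumpNormSq_pos hω₁ hω₂ m (x - s) (x + s)).ne'
  simp only [pivB]
  field_simp
  ring

theorem continuous_pivA (hω₁ : 0 ≤ ω₁) (hω₂ : 0 ≤ ω₂) (hs : 0 < s) (m : ℕ) (c e : ℝ) :
    Continuous fun t => pivA ω₁ ω₂ m c (t - s) (t + s) (t + e) := by
  have h1 := continuous_eval_jumpOP hω₁ hω₂ hs m e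
  have h2 := continuous_jumpNormSq hω₁ hω₂ hs m
  refine Continuous.div ?_ (by fun_prop) fun t =>
    mul_ne_zero two_ne_zero (jumpNormSq_pos hω₁ hω₂ m _ _).ne'
  simp only [jumpMass]
  fun_prop

theorem tendsto_abs_pivB (hω₁ : 0 ≤ ω₁) (hω₂ : 0 ≤ ω₂) (hs : 0 < s) (m : ℕ) {x e : ℝ}
    (h0 : (jumpOP ω₁ ω₂ m (x - s) (x + s)).eval (x + e) = 0) :
    Tendsto (fun t => |pivB ω₁ ω₂ m (t - s) (t + s) (t + e)|) (𝓝[≠] x) atTop := by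
  have hP := ((continuous_eval_jumpOP hω₁ hω₂ hs (m + 1) e).tendsto x).mono_left
    (nhdsWithin_le_nhds (s := {x}ᶜ))
  have hQ := ((continuous_eval_jumpOP hω₁ hω₂ hs m e).tendsto x).mono_left
    (nhdsWithin_le_nhds (s := {x}ᶜ))
  have hne := (isMonicOrthogonal_jumpOP hω₁ hω₂ (x - s) (x + s)).eval_succ_ne_zero h0
  rw [h0] at hQ
  have hQ' : Tendsto (fun t => |(jumpOP ω₁ ω₂ m (t - s) (t + s)).eval (t + e)|)
      (𝓝[≠] x) (𝓝[>] 0) := by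
    refine tendsto_nhdsWithin_iff.2 ⟨by simpa using hQ.abs, ?_⟩
    filter_upwards [eventually_eval_jumpOP_ne_zero hω₁ hω₂ hs m e x] with t ht
    exact abs_pos.2 ht
  have h := (hP.const_mul 2).abs.pos_mul_atTop (abs_pos.2 (mul_ne_zero two_ne_zero hne))
    hQ'.inv_tendsto_nhdsGT_zero
  refine h.congr fun t => ?_
  rw [pivB, abs_div, div_eq_mul_inv]
  rfl

theorem hasDerivAt_log_jumpGamma (hω₁ : 0 ≤ ω₁) (hω₂ : 0 ≤ ω₂) (hs : 0 < s) (m : ℕ) (x : ℝ) :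
    HasDerivAt (fun t => Real.log (jumpGamma ω₁ ω₂ m (t - s) (t + s)))
      (jumpAlpha ω₁ ω₂ m (x - s) (x + s)) x := by
  have hN := (jumpNormSq_pos hω₁ hω₂ m (x - s) (x + s)).ne'
  have e : ∀ t, Real.log (jumpGamma ω₁ ω₂ m (t - s) (t + s)) =
      -(Real.log (jumpNormSq ω₁ ω₂ m (t - s) (t + s)) / 2) := fun t => by
    rw [jumpGamma_eq, Real.log_inv, Real.log_sqrt (jumpNormSq_pos hω₁ hω₂ m _ _).le]
  simp only [e]
  refine (((hasDerivAt_jumpNormSq hω₁ hω₂ hs m x).log hN).div_const 2).fun_neg.congr_deriv ?_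
  field_simp

theorem hasDerivAt_pivY (hω₁ : 0 ≤ ω₁) (hω₂ : 0 ≤ ω₂) (hs : 0 < s) (m : ℕ) (x : ℝ) :
    HasDerivAt (fun t => pivY ω₁ ω₂ m t s)
      (2 * ((jumpAlpha ω₁ ω₂ m (x - s) (x + s) - x : ℝ) : ℂ) * pivY ω₁ ω₂ m x s) x := by
  have hN := (jumpNormSq_pos hω₁ hω₂ m (x - s) (x + s)).ne'
  have h1 : HasDerivAt (fun t => Real.exp (-t ^ 2) / jumpNormSq ω₁ ω₂ m (t - s) (t + s))
      (2 * (jumpAlpha ω₁ ω₂ m (x - s) (x + s) - x) *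
        (Real.exp (-x ^ 2) / jumpNormSq ω₁ ω₂ m (x - s) (x + s))) x := by
    refine ((hasDerivAt_pow 2 x).fun_neg.exp.fun_div
      (hasDerivAt_jumpNormSq hω₁ hω₂ hs m x) hN).congr_deriv ?_
    push_cast
    field_simp
    ring
  refine (h1.ofReal_comp.const_mul (4 * Real.pi * Complex.I : ℂ)).congr_deriv ?_
  simp only [pivY]
  push_cast
  ring

theorem jumpGamma_sq_eq_pivY (hω₁ : 0 ≤ ω₁) (hω₂ : 0 ≤ ω₂) (m : ℕ) (x s : ℝ) :
    ((jumpGamma ω₁ ω₂ m (x - s) (x + s) : ℝ) : ℂ) ^ 2 =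
      1 / (4 * Real.pi * Complex.I) * Complex.exp ((x : ℂ) ^ 2) * pivY ω₁ ω₂ m x s := by
  have hpi : (Real.pi : ℂ) ≠ 0 := Complex.ofReal_ne_zero.2 Real.pi_ne_zero
  have hN : (jumpNormSq ω₁ ω₂ m (x - s) (x + s) : ℂ) ≠ 0 :=
    Complex.ofReal_ne_zero.2 (jumpNormSq_pos hω₁ hω₂ m (x - s) (x + s)).ne'
  have hexp : Complex.exp ((x : ℂ) ^ 2) * Complex.exp (-(x : ℂ) ^ 2) = 1 := by
    rw [← Complex.exp_add, add_neg_cancel, Complex.exp_zero]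
  rw [← Complex.ofReal_pow, jumpGamma_sq hω₁ hω₂, pivY]
  push_cast
  field_simp
  exact hexp.symm

/-- The exponent `z = u² - x²` compensates the Gaussian factors `e^{-u²}` of `a_k` and `e^{-x²}`
of `y`. -/
theorem pivA_mul_pivB_sq_div_pivY (hω₁ : 0 ≤ ω₁) (hω₂ : 0 ≤ ω₂) (m : ℕ) {c x s u z : ℝ}
    (hc : c ≠ 0) (hz : z = u ^ 2 - x ^ 2)
    (hu : (jumpOP ω₁ ω₂ m (x - s) (x + s)).eval u ≠ 0) :
    2 * Real.pi * Complex.I / (c : ℂ) * Complex.exp z *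
        (pivA ω₁ ω₂ m c (x - s) (x + s) u * (pivB ω₁ ω₂ m (x - s) (x + s) u : ℂ) ^ 2 /
          pivY ω₁ ω₂ m x s) =
      (((jumpOP ω₁ ω₂ (m + 1) (x - s) (x + s)).eval u ^ 2 : ℝ) : ℂ) := by
  have hpi : (Real.pi : ℂ) ≠ 0 := Complex.ofReal_ne_zero.2 Real.pi_ne_zero
  have hc' : (c : ℂ) ≠ 0 := Complex.ofReal_ne_zero.2 hc
  have hN : (jumpNormSq ω₁ ω₂ m (x - s) (x + s) : ℂ) ≠ 0 :=
    Complex.ofReal_ne_zero.2 (jumpNormSq_pos hω₁ hω₂ m (x - s) (x + s)).ne'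
  have hexp : Complex.exp z * Complex.exp (-(u : ℂ) ^ 2) = Complex.exp (-(x : ℂ) ^ 2) := by
    rw [← Complex.exp_add, hz]
    push_cast
    ring_nf
  have hx := Complex.exp_ne_zero (-(x : ℂ) ^ 2)
  rw [← Complex.ofReal_pow, ← Complex.ofReal_mul, pivA_mul_pivB_sq _ _ _ _ hu, pivY, jumpMass]
  push_cast
  field_simp
  rw [← hexp]
  ring

end JumpWeight

/-! ### The main identities and differential equations -/

theorem mainTheorem1 (n : ℕ) (hn : 1 ≤ n) (ω₁ ω₂ : ℝ) (hω₁ : 0 ≤ ω₁) (hω₂ : 0 ≤ ω₂)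
    (h₁₂ : ω₁ ≠ ω₂) (h₁ : ω₁ ≠ 1) :
    -- the objects are well defined
    (∀ s₁ s₂ : ℝ, s₁ < s₂ →
      (∀ k : ℕ, Integrable (fun t => t ^ k * jumpWeight ω₁ ω₂ s₁ s₂ t)) ∧
      0 < hankelDet ω₁ ω₂ n s₁ s₂ ∧
      DifferentiableAt ℝ (fun u => Real.log (hankelDet ω₁ ω₂ n u s₂)) s₁ ∧
      DifferentiableAt ℝ (fun v => Real.log (hankelDet ω₁ ω₂ n s₁ v)) s₂ ∧
      (∀ m : ℕ, (jumpOP ω₁ ω₂ m s₁ s₂).Monic ∧ (jumpOP ω₁ ω₂ m s₁ s₂).natDegree = m ∧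
        0 < jumpGamma ω₁ ω₂ m s₁ s₂) ∧
      (∀ l m : ℕ,
        ∫ t, (jumpOP ω₁ ω₂ l s₁ s₂).eval t * (jumpOP ω₁ ω₂ m s₁ s₂).eval t *
            jumpWeight ω₁ ω₂ s₁ s₂ t =
          if l = m then (jumpGamma ω₁ ω₂ m s₁ s₂ ^ 2)⁻¹ else 0) ∧
      X * jumpOP ω₁ ω₂ n s₁ s₂ =
        jumpOP ω₁ ω₂ (n + 1) s₁ s₂ + C (jumpAlpha ω₁ ω₂ n s₁ s₂) * jumpOP ω₁ ω₂ n s₁ s₂ +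
          C (jumpBeta ω₁ ω₂ n s₁ s₂ ^ 2) * jumpOP ω₁ ω₂ (n - 1) s₁ s₂) ∧
    -- a solution of the coupled Painlevé IV system, as functions of `x` and `s > 0`, where
    -- `s₁ = x - s` and `s₂ = x + s`
    ∃ (a₁ a₂ b₁ b₂ : ℝ → ℝ → ℝ) (y : ℝ → ℝ → ℂ), ∀ s : ℝ, 0 < s →
      Continuous (fun x => a₁ x s) ∧ Continuous (fun x => a₂ x s) ∧
      -- the excluded points are isolated, and are poles of `b₁`, `b₂`
      (∀ x : ℝ, ∀ᶠ t in 𝓝[≠] x, t ∉ polesPIV ω₁ ω₂ n s) ∧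
      (∀ x : ℝ, (jumpOP ω₁ ω₂ (n - 1) (x - s) (x + s)).eval (x - s) = 0 →
        Tendsto (fun t => |b₁ t s|) (𝓝[≠] x) atTop) ∧
      (∀ x : ℝ, (jumpOP ω₁ ω₂ (n - 1) (x - s) (x + s)).eval (x + s) = 0 →
        Tendsto (fun t => |b₂ t s|) (𝓝[≠] x) atTop) ∧
      -- the differential equations
      (∀ x : ℝ, x ∉ polesPIV ω₁ ω₂ n s → SolvesCoupledPIVAt n a₁ a₂ b₁ b₂ s x) ∧
      (∀ x : ℝ, HasDerivAt (fun t => y t s) (2 * ((a₁ x s + a₂ x s - x : ℝ) : ℂ) * y x s) x) ∧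
      -- `F = H_IV - 2 n x`
      EqUpToRemovable (polesPIV ω₁ ω₂ n s)
        (fun x => hamiltonianIV n (a₁ x s) (a₂ x s) (b₁ x s) (b₂ x s) x s - 2 * n * x)
        (fun x => hankelLogDeriv ω₁ ω₂ n (x - s) (x + s)) ∧
      -- `α_n`
      EqUpToRemovable (polesPIV ω₁ ω₂ n s)
        (fun x => (a₁ x s * b₁ x s ^ 2 + a₂ x s * b₂ x s ^ 2) /
          (2 * (a₁ x s * b₁ x s + a₂ x s * b₂ x s + n)))
        (fun x => jumpAlpha ω₁ ω₂ n (x - s) (x + s)) ∧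
      (∀ x : ℝ, x ∉ polesPIV ω₁ ω₂ n s → a₁ x s * b₁ x s + a₂ x s * b₂ x s + n ≠ 0) ∧
      -- `β_n ^ 2`
      EqUpToRemovable (polesPIV ω₁ ω₂ n s)
        (fun x => 1 / 2 * (a₁ x s * b₁ x s + a₂ x s * b₂ x s + n))
        (fun x => jumpBeta ω₁ ω₂ n (x - s) (x + s) ^ 2) ∧
      -- `γ_{n-1} ^ 2`
      (∀ x : ℝ, ((jumpGamma ω₁ ω₂ (n - 1) (x - s) (x + s) : ℝ) : ℂ) ^ 2 =
          1 / (4 * Real.pi * Complex.I) * Complex.exp ((x : ℂ) ^ 2) * y x s ∧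
        1 / (4 * Real.pi * Complex.I) * Complex.exp ((x : ℂ) ^ 2) * y x s ≠ 0) ∧
      -- `d ln γ_{n-1} / dx`
      (∀ x : ℝ, HasDerivAt (fun t => Real.log (jumpGamma ω₁ ω₂ (n - 1) (t - s) (t + s)))
        (a₁ x s + a₂ x s) x) ∧
      -- `π_n(s₁) ^ 2`
      EqUpToRemovable (polesPIV ω₁ ω₂ n s)
        (fun x => 2 * Real.pi * Complex.I / ((ω₁ : ℂ) - 1) *
          Complex.exp (-2 * s * x + (s : ℂ) ^ 2) * (a₁ x s * (b₁ x s : ℂ) ^ 2 / y x s))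
        (fun x => (((jumpOP ω₁ ω₂ n (x - s) (x + s)).eval (x - s) ^ 2 : ℝ) : ℂ)) ∧
      -- `π_n(s₂) ^ 2`
      EqUpToRemovable (polesPIV ω₁ ω₂ n s)
        (fun x => 2 * Real.pi * Complex.I / ((ω₂ : ℂ) - ω₁) *
          Complex.exp (2 * s * x + (s : ℂ) ^ 2) * (a₂ x s * (b₂ x s : ℂ) ^ 2 / y x s))
        (fun x => (((jumpOP ω₁ ω₂ n (x - s) (x + s)).eval (x + s) ^ 2 : ℝ) : ℂ)) := by
  obtain ⟨m, rfl⟩ : ∃ m, n = m + 1 := ⟨n - 1, by omega⟩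
  simp only [polesPIV, Nat.add_sub_cancel]
  refine ⟨fun s₁ s₂ hs => ?_, ?_⟩
  · have hπ := isMonicOrthogonal_jumpOP hω₁ hω₂ s₁ s₂
    refine ⟨fun k => ?_, ?_, ?_, ?_, fun k => ⟨hπ.monic k, hπ.natDegree_eq k,
      jumpGamma_pos hω₁ hω₂ k s₁ s₂⟩, fun l k => ?_, ?_⟩
    · simpa only [eval_pow, eval_X] using integrable_eval_mul_jumpWeight ω₁ ω₂ s₁ s₂ (X ^ k)
    · rw [hankelDet_eq_prod hω₁ hω₂]
      exact Finset.prod_pos fun k _ => jumpNormSq_pos hω₁ hω₂ k s₁ s₂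
    · exact (hasDerivAt_log_hankelDet hω₁ hω₂ (m + 1) (hasDerivAt_id s₁) (hasDerivAt_const s₁ s₂)
        hs).differentiableAt
    · exact (hasDerivAt_log_hankelDet hω₁ hω₂ (m + 1) (hasDerivAt_const s₂ s₁) (hasDerivAt_id s₂)
        hs).differentiableAt
    · rw [jumpGamma_sq hω₁ hω₂, inv_inv]
      split_ifs with hlk
      · subst hlk
        simp only [jumpNormSq, jumpFunctional_apply, eval_mul]
      · simpa only [jumpFunctional_apply, eval_mul] using hπ.orthogonal l k hlk
    · rw [jumpAlpha_eq, jumpBeta_sq hω₁ hω₂]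
      exact hπ.recurrence m
  · refine ⟨fun x s => pivA ω₁ ω₂ m (ω₁ - 1) (x - s) (x + s) (x - s),
      fun x s => pivA ω₁ ω₂ m (ω₂ - ω₁) (x - s) (x + s) (x + s),
      fun x s => pivB ω₁ ω₂ m (x - s) (x + s) (x - s),
      fun x s => pivB ω₁ ω₂ m (x - s) (x + s) (x + s), pivY ω₁ ω₂ m, fun s hs => ?_⟩
    have hlt : ∀ x, x - s < x + s := fun x => by linarith
    have hα : ∀ x, _ := fun x => pivA_add_pivA hω₁ hω₂ m (hlt x)
    -- both jump points are of the form `t + e`, the first one with `e = -s`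
    have hiso : ∀ x : ℝ, ∀ᶠ t in 𝓝[≠] x, ¬((jumpOP ω₁ ω₂ m (t - s) (t + s)).eval (t - s) = 0 ∨
        (jumpOP ω₁ ω₂ m (t - s) (t + s)).eval (t + s) = 0) := fun x => by
      filter_upwards [eventually_eval_jumpOP_ne_zero hω₁ hω₂ hs m (-s) x,
        eventually_eval_jumpOP_ne_zero hω₁ hω₂ hs m s x] with t h1 h2
      exact not_or.2 ⟨by rwa [← sub_eq_add_neg] at h1, h2⟩
    have hcN := continuous_jumpNormSq hω₁ hω₂ hs
    have hcα := continuous_jumpAlpha hω₁ hω₂ hs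
    refine ⟨?_, ?_, hiso, ?_, ?_, ?_, ?_, ?_, ?_, ?_, ?_, ?_, ?_, ?_, ?_⟩
    · simpa only [← sub_eq_add_neg] using continuous_pivA hω₁ hω₂ hs m (ω₁ - 1) (-s)
    · exact continuous_pivA hω₁ hω₂ hs m (ω₂ - ω₁) s
    · intro x h0
      simpa only [← sub_eq_add_neg] using
        tendsto_abs_pivB hω₁ hω₂ hs m (e := -s) (by rwa [← sub_eq_add_neg])
    · exact fun x h0 => tendsto_abs_pivB hω₁ hω₂ hs m h0
    · -- the right-hand sides contain `a₁ + a₂ = α_m` and `a₁ b₁ + a₂ b₂ + n = 2 h_{m+1} / h_m`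
      intro x hx
      obtain ⟨hu₁, hu₂⟩ := not_or.1 hx
      have hS := sum_pivA_mul_pivB hω₁ hω₂ m (hlt x) hu₁ hu₂
      refine ⟨?_, ?_, ?_, ?_⟩
      · refine (hasDerivAt_pivA hω₁ hω₂ hs m _ ((hasDerivAt_id x).sub_const s) hu₁).congr_deriv ?_
        rw [← hα]
        simp only [id]
        ring
      · refine (hasDerivAt_pivA hω₁ hω₂ hs m _ ((hasDerivAt_id x).add_const s) hu₂).congr_deriv ?_
        rw [← hα]
        simp only [id]
        ring
      · refine (hasDerivAt_pivB hω₁ hω₂ hs m ((hasDerivAt_id x).sub_const s) hu₁).congr_deriv ?_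
        rw [← hα]
        simp only [id]
        linear_combination -2 * hS
      · refine (hasDerivAt_pivB hω₁ hω₂ hs m ((hasDerivAt_id x).add_const s) hu₂).congr_deriv ?_
        rw [← hα]
        simp only [id]
        linear_combination -2 * hS
    · intro x
      rw [hα]
      exact hasDerivAt_pivY hω₁ hω₂ hs m x
    · refine eqUpToRemovable_of_continuous hiso ?_ fun x hx => ?_
      · simp only [fun x => hankelLogDeriv_eq hω₁ hω₂ (m + 1) (hlt x)]
        exact continuous_const.mul (continuous_finsetSum _ fun k _ => hcα k)
      · obtain ⟨hu₁, hu₂⟩ := not_or.1 hx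
        exact hamiltonianIV_eq_hankelLogDeriv hω₁ hω₂ m hs hu₁ hu₂
    · refine eqUpToRemovable_of_continuous hiso (hcα (m + 1)) fun x hx => ?_
      obtain ⟨hu₁, hu₂⟩ := not_or.1 hx
      have h1 := jumpNormSq_pos hω₁ hω₂ (m + 1) (x - s) (x + s)
      have h0 := jumpNormSq_pos hω₁ hω₂ m (x - s) (x + s)
      simp only [sum_pivA_mul_pivB hω₁ hω₂ m (hlt x) hu₁ hu₂,
        sum_pivA_mul_pivB_sq hω₁ hω₂ m (hlt x) hu₁ hu₂]
      field_simp
      ring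
    · intro x hx
      obtain ⟨hu₁, hu₂⟩ := not_or.1 hx
      rw [sum_pivA_mul_pivB hω₁ hω₂ m (hlt x) hu₁ hu₂]
      exact mul_ne_zero two_ne_zero
        (div_pos (jumpNormSq_pos hω₁ hω₂ _ _ _) (jumpNormSq_pos hω₁ hω₂ _ _ _)).ne'
    · refine eqUpToRemovable_of_continuous hiso ?_ fun x hx => ?_
      · simp only [jumpBeta_sq hω₁ hω₂]
        exact (hcN (m + 1)).div (hcN m) fun x => (jumpNormSq_pos hω₁ hω₂ m _ _).ne'
      · obtain ⟨hu₁, hu₂⟩ := not_or.1 hx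
        rw [sum_pivA_mul_pivB hω₁ hω₂ m (hlt x) hu₁ hu₂, jumpBeta_sq hω₁ hω₂]
        ring
    · intro x
      have h := jumpGamma_sq_eq_pivY hω₁ hω₂ m x s
      refine ⟨h, ?_⟩
      rw [← h]
      exact pow_ne_zero 2 (Complex.ofReal_ne_zero.2 (jumpGamma_pos hω₁ hω₂ m _ _).ne')
    · intro x
      rw [hα]
      exact hasDerivAt_log_jumpGamma hω₁ hω₂ hs m x
    · refine eqUpToRemovable_of_continuous hiso ?_ fun x hx => ?_
      · have h := continuous_eval_jumpOP hω₁ hω₂ hs (m + 1) (-s)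
        simp only [← sub_eq_add_neg] at h
        exact Complex.continuous_ofReal.comp (h.pow 2)
      · have h := pivA_mul_pivB_sq_div_pivY hω₁ hω₂ m (s := s) (z := -2 * s * x + s ^ 2)
          (sub_ne_zero.2 h₁) (by ring) (not_or.1 hx).1
        push_cast at h ⊢
        exact h
    · refine eqUpToRemovable_of_continuous hiso ?_ fun x hx => ?_
      · exact Complex.continuous_ofReal.comp
          ((continuous_eval_jumpOP hω₁ hω₂ hs (m + 1) s).pow 2)
      · have h := pivA_mul_pivB_sq_div_pivY hω₁ hω₂ m (s := s) (z := 2 * s * x + s ^ 2)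
          (sub_ne_zero.2 h₁₂.symm) (by ring) (not_or.1 hx).2
        push_cast at h ⊢
        exact h
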